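/- **Setting.** Let $R$ be a ring with unit and $G$ a finitely generated infinite group. Let $R*G$ be a crossed product: there are maps $\sigma:G\to\mathrm{Aut}_{\rm ring}(R)$, $\rho:G\times G\to U(R)$ such that, writing $r^{\sigma(g)}$ for the image of $r$ under $\sigma(g)$, $$\rho(g_1,g_2)\rho(g_1g_2,g_3)=\rho(g_2,g_3)^{\sigma(g_1)}\rho(g_1,g_2g_3),\qquad (r^{\sigma(g_2)})^{\sigma(g_1)}=\rho(g_1,g_2)\,r^{\sigma(g_1g_2)}\rho(g_1,g_2)^{-1},$$ $\rho(g,e)=\rho(e,g)=1$, $\sigma(e)=\mathrm{id}$; and $R*G$ is the ring of finite formal sums $\sum_g r_g\underline g$ with componentwise addition and the biadditive product determined by $(r\underline g)(s\underline h)=r\,s^{\sigma(g)}\rho(g,h)\,\underline{gh}$. It contains $R$ via $r\mapsto r\underline e$. Modules are left modules. For finite $C,A\subseteq G$ let $\partial_C(A)=\{x: xC\cap A\ne\emptyset,\ xC\not\subseteq A\}$. A *Følner net* is a net $(F_i)$ of non-empty finite subsets of $G$ with $|\partial_C(F_i)|/|F_i|\to 0$ for all finite $C\subseteq G$; a *Følner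 sequence* is one indexed by $\mathbb N$. Assume that $G$ is amenable, that is, that it has a Følner net. A *length function* on a class $\mathcal C$ of modules closed under submodules and quotients is a map $\ell:\mathcal C\to\mathbb R_{\ge0}\cup\{\infty\}$ that is invariant under isomorphism, *additive* ($\ell(0)=0$, and $\ell(B)=\ell(A)+\ell(C)$ for every short exact sequence $0\to A\to B\to C\to0$ in $\mathcal C$) and *upper continuous* ($\ell(M)=\sup_{N\in S}\ell(N)$ whenever $M\in\mathcal C$ is the sum of a directed set $S$ of submodules). Let $L$ be a length function on the class of all $R$-modules such that * $L$ is *discrete*: its set of finite values is order-isomorphic to $\mathbb N$; * $L$ is *compatible with $R*G$*: for all $g\in G$ and all $R$-modules $M$, $L$ takes the same value on $M$ and on the module obtained from $M$ by restriction of scalars along $\sigma(g)$. An $R$-module $K$ is *$L$-finite* if $L(K)<\infty$. Let $\mathrm{lFin}_L(R*G)$ be the class of $R*G$-modules all of whose finitely generated $R$-submodules are $L$-finite. For $M$ in this class, an $L$-finite $R$-submodule $K\le M$ and a Følner sequence $(F_n)$, put $$\mathrm{ent}_L(M,K)=\lim_{n\to\infty}\frac{L\big(\sum_{g\in F_n}\underline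 g K\big)}{|F_n|},\qquad \mathrm{ent}_L(M)=\sup\{\mathrm{ent}_L(M,K): K\le M \text{ an } L\text{-finite } R\text{-submodule}\}.$$ **Theorem.** Følner sequences exist, and the limit defining $\mathrm{ent}_L(M,K)$ exists and does not depend on the Følner sequence. The resulting invariant $\mathrm{ent}_L:\mathrm{lFin}_L(R*G)\to\mathbb R_{\ge0}\cup\{\infty\}$ has the following properties. 1. $\mathrm{ent}_L$ is upper continuous. 2. For every $L$-finite $R$-module $K$, the module $R*G\otimes_RK$ belongs to $\mathrm{lFin}_L(R*G)$ and $\mathrm{ent}_L(R*G\otimes_RK)=L(K)$. 3. For every $L$-finite $R$-module $K$ and every $R*G$-submodule $N\le R*G\otimes_RK$: $\mathrm{ent}_L(N)=0$ if and only if $L(N)=0$. 4. $\mathrm{ent}_L$ is additive. In particular, $\mathrm{ent}_L$ is a length function on $\mathrm{lFin}_L(R*G)$. -/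

import Mathlib

open scoped ENNReal Topology TensorProduct

universe u v w

/-! ### Invariants of modules and length functions -/

/-- A function assigning a value in `ℝ≥0 ∪ {∞}` to every left module over `A`. -/
abbrev ModuleInvariant (A : Type u) [Ring A] : Type (max u (w + 1)) :=
  ∀ (M : Type w) [AddCommGroup M] [Module A M], ℝ≥0∞

/-- A class of left modules over `A`. -/
abbrev ModuleClass (A : Type u) [Ring A] : Type (max u (w + 1)) :=
  ∀ (M : Type w) [AddCommGroup M] [Module A M], Prop

/-- `ℓ` takes the same value on isomorphic modules of the class `C`. -/
def IsInvariantOn {A : Type u} [Ring A] (C : ModuleClass.{u, w} A)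
    (ℓ : ModuleInvariant.{u, w} A) : Prop :=
  ∀ (M N : Type w) [AddCommGroup M] [Module A M] [AddCommGroup N] [Module A N],
    C M → C N → Nonempty (M ≃ₗ[A] N) → ℓ M = ℓ N

/-- `ℓ` is additive on the class `C`: it vanishes on zero modules, and `ℓ M = ℓ N + ℓ P` for every
short exact sequence `0 → N → M → P → 0` whose middle term is in `C`.  (The class is meant to be
closed under submodules and quotients, so that the outer terms are in `C` as well.) -/
def IsAdditiveOn {A : Type u} [Ring A] (C : ModuleClass.{u, w} A)
    (ℓ : ModuleInvariant.{u, w} A) : Prop :=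
  (∀ (M : Type w) [AddCommGroup M] [Module A M], Subsingleton M → ℓ M = 0) ∧
  ∀ (N M P : Type w) [AddCommGroup N] [Module A N] [AddCommGroup M] [Module A M]
    [AddCommGroup P] [Module A P] (f : N →ₗ[A] M) (g : M →ₗ[A] P),
    C M → Function.Injective f → Function.Exact f g → Function.Surjective g →
      ℓ M = ℓ N + ℓ P

/-- `ℓ` is upper continuous on the class `C`: if `M` in `C` is the sum of a directed set `S` of
submodules, then `ℓ M` is the supremum of the values of `ℓ` on `S`. -/
def IsUpperContinuousOn {A : Type u} [Ring A] (C : ModuleClass.{u, w} A)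
    (ℓ : ModuleInvariant.{u, w} A) : Prop :=
  ∀ (M : Type w) [AddCommGroup M] [Module A M], C M →
    ∀ S : Set (Submodule A M), S.Nonempty → DirectedOn (· ≤ ·) S → sSup S = ⊤ →
      ℓ M = ⨆ N ∈ S, ℓ N

/-- Length functions on a class of modules. -/
structure IsLengthFunctionOn {A : Type u} [Ring A] (C : ModuleClass.{u, w} A)
    (ℓ : ModuleInvariant.{u, w} A) : Prop where
  invariant : IsInvariantOn C ℓ
  additive : IsAdditiveOn C ℓ
  upperContinuous : IsUpperContinuousOn C ℓ

/-- Length functions on the category of all left `A`-modules. -/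
def IsLengthFunction {A : Type u} [Ring A] (ℓ : ModuleInvariant.{u, w} A) : Prop :=
  IsLengthFunctionOn (fun _ _ _ => True) ℓ

/-- The set of finite values of an invariant. -/
def finiteValues {A : Type u} [Ring A] (ℓ : ModuleInvariant.{u, w} A) : Set ℝ≥0∞ :=
  {x | x ≠ ∞ ∧ ∃ (M : Type w) (_ : AddCommGroup M) (_ : Module A M), ℓ M = x}

/-- `ℓ` is discrete: its set of finite values is order-isomorphic to `ℕ`. -/
def IsDiscreteInvariant {A : Type u} [Ring A] (ℓ : ModuleInvariant.{u, w} A) : Prop :=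
  Nonempty (finiteValues ℓ ≃o ℕ)

/-! ### Restriction and extension of scalars along a homomorphism of arbitrary rings -/

/-- The module `M` over `S`, seen as a module over `R` through `f : R →+* S`. -/
def ResScalars {R : Type u} {S : Type v} [Ring R] [Ring S] (_f : R →+* S) (M : Type w) : Type w :=
  M

instance {R : Type u} {S : Type v} [Ring R] [Ring S] (f : R →+* S) (M : Type w)
    [AddCommGroup M] : AddCommGroup (ResScalars f M) :=
  inferInstanceAs (AddCommGroup M)

/-- `r` acts on `M` as `f r`. -/
instance {R : Type u} {S : Type v} [Ring R] [Ring S] (f : R →+* S) (M : Type w)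
    [AddCommGroup M] [Module S M] : Module R (ResScalars f M) :=
  Module.compHom M f

/-- The relations `(s * f r) ⊗ k = s ⊗ (r • k)` that turn `S ⊗[ℤ] K` into `S ⊗_R K`.  The set of
these relations is stable under multiplication by `S` on the left. -/
def balancedRelations {R : Type u} {S : Type v} [Ring R] [Ring S] (f : R →+* S) (K : Type w)
    [AddCommGroup K] [Module R K] : Submodule S (S ⊗[ℤ] K) :=
  Submodule.span S {x | ∃ (s : S) (r : R) (k : K), x = (s * f r) ⊗ₜ[ℤ] k - s ⊗ₜ[ℤ] (r • k)}

/-- The left `S`-module `S ⊗_R K`, for a homomorphism `f : R →+* S` of (not necessarily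
commutative) rings and a left `R`-module `K`; `S` is a right `R`-module through `f`. -/
abbrev ExtScalars {R : Type u} {S : Type v} [Ring R] [Ring S] (f : R →+* S) (K : Type w)
    [AddCommGroup K] [Module R K] : Type (max v w) :=
  (S ⊗[ℤ] K) ⧸ balancedRelations f K

/-! ### Crossed products -/

/-- The data `σ : G → Aut(R)`, `ρ : G × G → U(R)` defining a crossed product of `R` with `G`. -/
structure CrossedSystem (R : Type u) (G : Type v) [Ring R] [Group G] where
  σ : G → (R ≃+* R)
  ρ : G → G → Rˣ
  cocycle : ∀ g₁ g₂ g₃ : G,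
    (ρ g₁ g₂ : R) * ρ (g₁ * g₂) g₃ = σ g₁ (ρ g₂ g₃) * ρ g₁ (g₂ * g₃)
  twist : ∀ (g₁ g₂ : G) (r : R),
    σ g₁ (σ g₂ r) = ρ g₁ g₂ * σ (g₁ * g₂) r * ((ρ g₁ g₂)⁻¹ : Rˣ)
  ρ_one_right : ∀ g : G, ρ g 1 = 1
  ρ_one_left : ∀ g : G, ρ 1 g = 1
  σ_one : σ 1 = RingEquiv.refl R

/-- The crossed product `R * G`: formal finite sums `∑ r_g u_g`. -/
def CrossedProduct {R : Type u} {G : Type v} [Ring R] [Group G] (_c : CrossedSystem R G) :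
    Type (max u v) :=
  G →₀ R

namespace CrossedProduct

variable {R : Type u} {G : Type v} [Ring R] [Group G] (c : CrossedSystem R G)

noncomputable instance : AddCommGroup (CrossedProduct c) :=
  inferInstanceAs (AddCommGroup (G →₀ R))

/-- The element `r u_g`. -/
noncomputable def single (g : G) : R →+ CrossedProduct c :=
  Finsupp.singleAddHom (M := R) g

variable {c} in
theorem addHom_ext {A : Type*} [AddCommMonoid A] {f₁ f₂ : CrossedProduct c →+ A}
    (h : ∀ g r, f₁ (single c g r) = f₂ (single c g r)) : f₁ = f₂ :=
  Finsupp.addHom_ext (M := R) (f := f₁) (g := f₂) h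

variable {c} in
/-- The additive map on `R * G` with given values on the elements `r u_g`. -/
noncomputable def lift {A : Type*} [AddCommMonoid A] (φ : G → R →+ A) : CrossedProduct c →+ A :=
  Finsupp.liftAddHom (M := R) φ

variable {c} in
theorem lift_single {A : Type*} [AddCommMonoid A] (φ : G → R →+ A) (g : G) (r : R) :
    lift (c := c) φ (single c g r) = φ g r :=
  Finsupp.liftAddHom_apply_single (M := R) φ g r

/-- `(r u_g) (s u_h) = r s^{σ(g)} ρ(g,h) u_{gh}`, as an additive map in `r` and in `s`. -/
noncomputable def mulSingle (g h : G) : R →+ R →+ CrossedProduct c :=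
  AddMonoidHom.mk' (fun r => AddMonoidHom.mk'
      (fun s => single c (g * h) (r * c.σ g s * c.ρ g h))
      (fun s t => by rw [← map_add, map_add (c.σ g), mul_add, add_mul]))
    (fun r t => by
      ext s
      change single c _ _ = single c _ _ + single c _ _
      rw [← map_add, add_mul, add_mul])

/-- The product of `R * G`: the biadditive map given by `mulSingle` on the elements `r u_g`. -/
noncomputable def mulHom : CrossedProduct c →+ CrossedProduct c →+ CrossedProduct c :=
  lift fun g => AddMonoidHom.mk' (fun r => lift fun h => mulSingle c g h r) (fun r t =>
    addHom_ext fun h s => by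
      rw [AddMonoidHom.add_apply, lift_single, lift_single, lift_single, map_add]; rfl)

noncomputable instance : Mul (CrossedProduct c) := ⟨fun x y => mulHom c x y⟩

noncomputable instance : One (CrossedProduct c) := ⟨single c 1 1⟩

theorem mulHom_single_single (g h : G) (r s : R) :
    mulHom c (single c g r) (single c h s) = single c (g * h) (r * c.σ g s * c.ρ g h) := by
  rw [mulHom, lift_single, AddMonoidHom.mk'_apply, lift_single]; rfl

theorem single_mul_single (g h : G) (r s : R) :
    single c g r * single c h s = single c (g * h) (r * c.σ g s * c.ρ g h) :=
  mulHom_single_single c g h r s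

theorem one_def : (1 : CrossedProduct c) = single c 1 1 := rfl

theorem mulHom_assoc (x y z : CrossedProduct c) :
    mulHom c (mulHom c x y) z = mulHom c x (mulHom c y z) := by
  -- both sides are additive in each of `x`, `y`, `z`, so they may be compared on the `r u_g`
  have h₁ : ∀ g h k r s t, mulHom c (mulHom c (single c g r) (single c h s)) (single c k t) =
      mulHom c (single c g r) (mulHom c (single c h s) (single c k t)) := by
    intro g h k r s t
    simp only [mulHom_single_single, map_mul, c.twist]
    rw [mul_assoc g h k]
    congr 1
    simp only [mul_assoc]
    rw [← c.cocycle, Units.inv_mul_cancel_left]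
  have h₂ : ∀ g h r s, mulHom c (mulHom c (single c g r) (single c h s)) z =
      mulHom c (single c g r) (mulHom c (single c h s) z) := fun g h r s =>
    DFunLike.congr_fun (f := mulHom c (mulHom c (single c g r) (single c h s)))
      (g := (mulHom c (single c g r)).comp (mulHom c (single c h s)))
      (addHom_ext fun k t => h₁ g h k r s t) z
  have h₃ : ∀ g r, mulHom c (mulHom c (single c g r) y) z =
      mulHom c (single c g r) (mulHom c y z) := fun g r =>
    DFunLike.congr_fun (f := ((mulHom c).flip z).comp (mulHom c (single c g r)))
      (g := (mulHom c (single c g r)).comp ((mulHom c).flip z))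
      (addHom_ext fun h s => h₂ g h r s) y
  exact DFunLike.congr_fun (f := ((mulHom c).flip z).comp ((mulHom c).flip y))
    (g := (mulHom c).flip (mulHom c y z)) (addHom_ext fun g r => h₃ g r) x

noncomputable instance : Ring (CrossedProduct c) :=
  { (inferInstance : AddCommGroup (CrossedProduct c)),
    (inferInstance : Mul (CrossedProduct c)),
    (inferInstance : One (CrossedProduct c)) with
    left_distrib := fun x y z => map_add (mulHom c x) y z
    right_distrib := fun x y z => by
      change mulHom c (x + y) z = mulHom c x z + mulHom c y z
      rw [map_add, AddMonoidHom.add_apply]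
    zero_mul := fun x => by
      change mulHom c 0 x = 0
      rw [map_zero, AddMonoidHom.zero_apply]
    mul_zero := fun x => map_zero (mulHom c x)
    one_mul := fun x => by
      change mulHom c 1 x = AddMonoidHom.id _ x
      refine DFunLike.congr_fun (addHom_ext fun g r => ?_) x
      refine (single_mul_single c 1 g 1 r).trans ?_
      simp [c.σ_one, c.ρ_one_left]
    mul_one := fun x => by
      change (mulHom c).flip 1 x = AddMonoidHom.id _ x
      refine DFunLike.congr_fun (addHom_ext fun g r => ?_) x
      refine (single_mul_single c g 1 r 1).trans ?_
      simp [c.ρ_one_right]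
    mul_assoc := mulHom_assoc c }

/-- The embedding `r ↦ r u_e` of `R` in `R * G`. -/
noncomputable def ofRing : R →+* CrossedProduct c :=
  { single c 1 with
    map_one' := rfl
    map_mul' := fun r s => by
      change single c 1 (r * s) = single c 1 r * single c 1 s
      rw [single_mul_single]
      simp [c.σ_one, c.ρ_one_left] }

/-- The element `u_g`. -/
noncomputable def basis (g : G) : CrossedProduct c := single c g 1

theorem basis_mul_ofRing (g : G) (r : R) :
    basis c g * ofRing c r = ofRing c (c.σ g r) * basis c g := by
  change single c g 1 * single c 1 r = single c 1 (c.σ g r) * single c g 1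
  rw [single_mul_single, single_mul_single]
  simp [c.σ_one, c.ρ_one_left, c.ρ_one_right]

end CrossedProduct

/-! ### Amenable groups -/

section Amenable

variable {G : Type v} [Group G]

/-- The `C`-interior `{x | x C ⊆ A}` of `A`. -/
def cInterior (C A : Set G) : Set G := {x | ∀ y ∈ C, x * y ∈ A}

/-- The `C`-exterior `{x | x C ∩ A ≠ ∅}` of `A`. -/
def cExterior (C A : Set G) : Set G := {x | ∃ y ∈ C, x * y ∈ A}

/-- The `C`-boundary of `A`; it is a finite set when `C` and `A` are finite. -/
def cBoundary (C A : Set G) : Set G := cExterior C A \ cInterior C A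

/-- Følner nets: nets of finite non-empty subsets of `G` with `|∂_C(F_i)| / |F_i| → 0` for every
finite `C ⊆ G`. -/
def IsFolnerNet {I : Type*} [Preorder I] (F : I → Finset G) : Prop :=
  (∀ i, (F i).Nonempty) ∧
  ∀ C : Finset G, Filter.Tendsto
    (fun i => ((cBoundary (C : Set G) (F i : Set G)).ncard : ℝ) / ((F i).card : ℝ))
    Filter.atTop (𝓝 0)

/-- Følner sequences. -/
def IsFolnerSeq (F : ℕ → Finset G) : Prop := IsFolnerNet F

/-- `G` is amenable if it has a Følner net. -/
def IsAmenable (G : Type v) [Group G] : Prop :=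
  ∃ (I : Type v) (_ : Preorder I) (_ : Nonempty I) (_ : IsDirectedOrder I) (F : I → Finset G),
    IsFolnerNet F

end Amenable

/-! ### The algebraic entropy -/

section Entropy

variable {R : Type u} {G : Type v} [Ring R] [Group G]

/-- `L` is compatible with `R * G`: it is unchanged by restriction of scalars along each of the
automorphisms `σ(g)` of `R`. -/
def IsCompatibleWith (c : CrossedSystem R G) (L : ModuleInvariant.{u, w} R) : Prop :=
  ∀ (g : G) (M : Type w) [AddCommGroup M] [Module R M],
    L (ResScalars (c.σ g : R →+* R) M) = L M

/-- The `R`-module underlying an `R * G`-module. -/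
abbrev RMod (c : CrossedSystem R G) (M : Type w) : Type w :=
  ResScalars (CrossedProduct.ofRing c) M

variable (c : CrossedSystem R G)

/-- `m ↦ u_g m`, a `σ(g)`-semilinear map. -/
noncomputable def basisAction (M : Type w) [AddCommGroup M] [Module (CrossedProduct c) M] (g : G) :
    RMod c M →ₛₗ[(c.σ g : R →+* R)] RMod c M where
  toFun := fun m : M => CrossedProduct.basis c g • m
  map_add' := fun m n : M => smul_add (CrossedProduct.basis c g) m n
  map_smul' := fun (r : R) (m : M) => by
    change CrossedProduct.basis c g • (CrossedProduct.ofRing c r • m) =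
      CrossedProduct.ofRing c (c.σ g r) • (CrossedProduct.basis c g • m)
    rw [smul_smul, smul_smul, CrossedProduct.basis_mul_ofRing]

/-- `λ_g(K) = u_g K`. -/
noncomputable def translateSubmodule {M : Type w} [AddCommGroup M] [Module (CrossedProduct c) M]
    (g : G) (K : Submodule R (RMod c M)) : Submodule R (RMod c M) :=
  K.map (basisAction c M g)

/-- The trajectory `T_F(λ, K) = ∑_{g ∈ F} λ_g(K)`. -/
noncomputable def trajectory {M : Type w} [AddCommGroup M] [Module (CrossedProduct c) M]
    (F : Finset G) (K : Submodule R (RMod c M)) : Submodule R (RMod c M) :=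
  ⨆ g ∈ F, translateSubmodule c g K

/-- The class `lFin_L(R * G)` of the `R * G`-modules all of whose finitely generated
`R`-submodules have finite `L`. -/
def lFin (L : ModuleInvariant.{u, w} R) : ModuleClass.{max u v, w} (CrossedProduct c) :=
  fun M _ _ => ∀ K : Submodule R (RMod c M), K.FG → L K ≠ ∞

/-- `L(T_{F_n}(λ, K)) / |F_n|`. -/
noncomputable def entropyTerm (L : ModuleInvariant.{u, w} R) (F : ℕ → Finset G)
    {M : Type w} [AddCommGroup M] [Module (CrossedProduct c) M]
    (K : Submodule R (RMod c M)) (n : ℕ) : ℝ≥0∞ :=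
  L (trajectory c (F n) K) / ((F n).card : ℝ≥0∞)

/-- The `L`-entropy with respect to `K`, computed along `F`: the limit of `entropyTerm`. -/
noncomputable def entropyAt (L : ModuleInvariant.{u, w} R) (F : ℕ → Finset G)
    {M : Type w} [AddCommGroup M] [Module (CrossedProduct c) M]
    (K : Submodule R (RMod c M)) : ℝ≥0∞ :=
  Filter.limUnder Filter.atTop (entropyTerm c L F K)

/-- The algebraic `L`-entropy, computed along `F`: the supremum of the entropies with respect to
the `L`-finite `R`-submodules. -/
noncomputable def algEntropy (L : ModuleInvariant.{u, w} R) (F : ℕ → Finset G) :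
    ModuleInvariant.{max u v, w} (CrossedProduct c) :=
  fun M _ _ => ⨆ (K : Submodule R (RMod c M)) (_ : L K ≠ ∞), entropyAt c L F K

/-- The Bernoulli shift `(R * G) ⊗_R K`. -/
abbrev BernoulliShift (K : Type w) [AddCommGroup K] [Module R K] : Type (max u v w) :=
  ExtScalars (CrossedProduct.ofRing c) K

end Entropy

/-! ### Length functions on submodules -/

namespace IsLengthFunction

variable {A : Type u} [Ring A] {L : ModuleInvariant.{u, w} A}
  {M N P : Type w} [AddCommGroup M] [Module A M] [AddCommGroup N] [Module A N]
  [AddCommGroup P] [Module A P]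

/-! Everything rests on one inequality, `entropyInf_add_le`. Write T_D(K) for the trajectory and
e(K) for the infimum of L(T_D(K))/|D| over non-empty finite D. If K is L-finite and H ≤ T_D(K), then
e(K) + L(H)/|D| ≤ e(H) + L(T_D(K))/|D|. It comes from Shearer's inequality
(`mul_le_sum_of_submodular`), applied to the submodular function S ↦ L((T_S(K) + B)/B) with B =
T_F(H): the sets gD with g ∈ F cover almost every point of F exactly |D| times, and modulo B each
piece u_g T_D(K) loses at least L(H). Letting F run through a Følner sequence removes the boundary
error.

The choices of H give the theorem. With H = 0 at the finite stage, the defining sequence converges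
to e(K), whatever the Følner sequence. With D = {1} and L(H) = L(K), one gets e(H) = e(K); as a
discrete L attains its value on a finitely generated submodule, such submodules compute the entropy,
whence upper continuity. With H = T_D(K) ∩ N, for a submodule N with quotient P, one gets the hard
half of additivity, since L(T_D(K)) - L(H) is the length of the trajectory of the image of K in P.
In a Bernoulli shift the translates of K are independent, so e(K) = L(T_D(K))/|D| = L(K); the
inequality then reads L(H)/|D| ≤ e(H), so a submodule of zero entropy has zero length. -/

theorem congr (hL : IsLengthFunction L) (e : M ≃ₗ[A] N) : L M = L N :=
  hL.invariant M N trivial trivial ⟨e⟩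

theorem of_subsingleton (hL : IsLengthFunction L) (h : Subsingleton M) : L M = 0 :=
  hL.additive.1 M h

theorem bot (hL : IsLengthFunction L) : L (⊥ : Submodule A M) = 0 :=
  hL.of_subsingleton inferInstance

theorem top (hL : IsLengthFunction L) : L (⊤ : Submodule A M) = L M :=
  hL.congr Submodule.topEquiv

theorem map_of_injective (hL : IsLengthFunction L) {f : M →ₗ[A] N} (hf : Function.Injective f)
    (K : Submodule A M) : L (K.map f) = L K :=
  (hL.congr (Submodule.equivMapOfInjective f hf K)).symm

/-- Additivity, for the restriction of a linear map to a submodule. -/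
theorem inf_ker_add_map (hL : IsLengthFunction L) (f : M →ₗ[A] N) (K : Submodule A M) :
    L K = L (K ⊓ LinearMap.ker f : Submodule A M) + L (K.map f) := by
  refine hL.additive.2 _ _ _ (Submodule.inclusion inf_le_left) (f.submoduleMap K) trivial
    (Submodule.inclusion_injective _) ?_ (f.submoduleMap_surjective K)
  rintro ⟨x, hx⟩
  constructor
  · intro h
    have h' : f x = 0 := congrArg Subtype.val h
    exact ⟨⟨x, hx, h'⟩, rfl⟩
  · rintro ⟨⟨y, hy, hy'⟩, h⟩
    obtain rfl : y = x := congrArg Subtype.val h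
    exact Subtype.ext hy'

theorem map_le (hL : IsLengthFunction L) (f : M →ₗ[A] N) (K : Submodule A M) :
    L (K.map f) ≤ L K :=
  (hL.inf_ker_add_map f K).symm ▸ le_add_self

theorem mono (hL : IsLengthFunction L) {H K : Submodule A M} (h : H ≤ K) : L H ≤ L K := by
  have := hL.inf_ker_add_map H.mkQ K
  rw [Submodule.ker_mkQ, inf_eq_right.2 h] at this
  exact this ▸ le_self_add

/-- Second isomorphism theorem: H ⊔ K and H have the same image modulo K. The additive form avoids
subtraction in `ℝ≥0∞`. -/
theorem sup_add_inf (hL : IsLengthFunction L) (H K : Submodule A M) :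
    L (H ⊔ K : Submodule A M) + L (H ⊓ K : Submodule A M) = L H + L K := by
  have h₁ := hL.inf_ker_add_map K.mkQ (H ⊔ K)
  have h₂ := hL.inf_ker_add_map K.mkQ H
  rw [Submodule.ker_mkQ] at h₁ h₂
  rw [inf_eq_right.2 le_sup_right, Submodule.map_sup, Submodule.mkQ_map_self, sup_bot_eq] at h₁
  rw [h₁, h₂]
  ring

theorem sup_le (hL : IsLengthFunction L) (H K : Submodule A M) :
    L (H ⊔ K : Submodule A M) ≤ L H + L K :=
  hL.sup_add_inf H K ▸ le_self_add

theorem sup_ne_top (hL : IsLengthFunction L) {H K : Submodule A M} (hH : L H ≠ ∞)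
    (hK : L K ≠ ∞) : L (H ⊔ K : Submodule A M) ≠ ∞ :=
  ne_top_of_le_ne_top (ENNReal.add_ne_top.2 ⟨hH, hK⟩) (hL.sup_le H K)

theorem eq_iSup_fg (hL : IsLengthFunction L) :
    L M = ⨆ H ∈ {H : Submodule A M | H.FG}, L H := by
  refine hL.upperContinuous M trivial _ ⟨⊥, Submodule.fg_bot⟩ ?_ ?_
  · intro H hH K hK
    exact ⟨H ⊔ K, Submodule.FG.sup hH hK, le_sup_left, le_sup_right⟩
  · refine eq_top_iff.2 fun x _ => ?_
    exact (le_sSup (show Submodule.span A {x} ∈ {H : Submodule A M | H.FG} from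
      Submodule.fg_span_singleton x)) (Submodule.mem_span_singleton_self x)

/-- The length of a module vanishes as soon as it vanishes on finitely generated submodules. -/
theorem eq_zero_of_fg (hL : IsLengthFunction L) (h : ∀ H : Submodule A M, H.FG → L H = 0) :
    L M = 0 := by
  rw [hL.eq_iSup_fg]
  simpa using h

end IsLengthFunction

/-- In a set of extended reals of order type `ω`, a supremum is attained. -/
theorem exists_eq_of_iSup_eq_of_orderIso_nat {X : Set ℝ≥0∞} (e : X ≃o ℕ) {ι : Type*} [Nonempty ι]
    {f : ι → ℝ≥0∞} (hf : ∀ i, f i ∈ X) {a : ℝ≥0∞} (ha : a ∈ X) (h : a = ⨆ i, f i) :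
    ∃ i, f i = a := by
  by_contra! hne
  have hlt : ∀ i, f i < a := fun i => lt_of_le_of_ne (h ▸ le_iSup f i) (hne i)
  have hlt' : ∀ i, e ⟨f i, hf i⟩ < e ⟨a, ha⟩ := fun i => e.lt_iff_lt.2 (hlt i)
  -- Some value lies strictly below `a`, so the position of `a` in ℕ is positive and the truncated
  -- subtraction gives its true predecessor. That predecessor bounds all the values, so their
  -- supremum could not be `a`.
  have hpos : e ⟨a, ha⟩ - 1 < e ⟨a, ha⟩ := by
    have := hlt' (Classical.arbitrary ι)
    omega
  have hb : e.symm (e ⟨a, ha⟩ - 1) < ⟨a, ha⟩ := by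
    rw [← e.lt_iff_lt, e.apply_symm_apply]
    exact hpos
  refine (lt_of_le_of_lt (iSup_le fun i => ?_) (Subtype.coe_lt_coe.2 hb)).ne' h
  have : (⟨f i, hf i⟩ : X) ≤ e.symm (e ⟨a, ha⟩ - 1) := by
    rw [← e.le_iff_le, e.apply_symm_apply]
    have := hlt' i
    omega
  exact this

/-- For a discrete length function, the length of an `L`-finite submodule is attained on a finitely
generated one. -/
theorem IsLengthFunction.exists_fg_le_eq {A : Type u} [Ring A] {L : ModuleInvariant.{u, w} A}
    (hL : IsLengthFunction L) (hLd : IsDiscreteInvariant L) {M : Type w} [AddCommGroup M]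
    [Module A M] {K : Submodule A M} (hK : L K ≠ ∞) :
    ∃ H ≤ K, H.FG ∧ L H = L K := by
  obtain ⟨e⟩ := hLd
  have hle : ∀ H : Submodule A K, L H ≤ L K := fun H => hL.top (M := K) ▸ hL.mono le_top
  have : Nonempty {H : Submodule A K // H.FG} := ⟨⟨⊥, Submodule.fg_bot⟩⟩
  obtain ⟨⟨H, hH⟩, h⟩ := exists_eq_of_iSup_eq_of_orderIso_nat e
    (f := fun H : {H : Submodule A K // H.FG} => L H.1)
    (fun H => ⟨ne_top_of_le_ne_top hK (hle _), _, _, _, rfl⟩) ⟨hK, _, _, _, rfl⟩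
    (by rw [hL.eq_iSup_fg (M := K), iSup_subtype]; rfl)
  exact ⟨H.map K.subtype, Submodule.map_subtype_le K H, hH.map _,
    (hL.map_of_injective K.injective_subtype H).trans h⟩

/-! ### Submodular functions -/

/-- Shearer's inequality: if `f` is monotone and submodular with `f ∅ = 0`, and every point of `F`
lies in at least `k` of the sets `D i`, then `k f(F) ≤ ∑ f(D i)`. -/
theorem mul_le_sum_of_submodular {α ι : Type*} [DecidableEq α] {f : Finset α → ℝ}
    (h₀ : f ∅ = 0) (hmono : ∀ ⦃S T⦄, S ⊆ T → f S ≤ f T)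
    (hsub : ∀ S T, f (S ∪ T) + f (S ∩ T) ≤ f S + f T) (I : Finset ι) (D : ι → Finset α) (k : ℕ)
    (F : Finset α) (hk : ∀ x ∈ F, k ≤ (I.filter fun i => x ∈ D i).card) :
    k * f F ≤ ∑ i ∈ I, f (D i) := by
  -- Cutting the sets down to `F` makes induction on `F` possible: adding `x` changes only the sets
  -- that contain it.
  suffices h : k * f F ≤ ∑ i ∈ I, f (D i ∩ F) from
    h.trans (Finset.sum_le_sum fun i _ => hmono Finset.inter_subset_left)
  induction F using Finset.induction_on with
  | empty => simp [h₀]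
  | insert x F hx ih =>
    have ih := ih fun y hy => hk y (Finset.mem_insert_of_mem hy)
    have hδ : 0 ≤ f (insert x F) - f F := sub_nonneg.2 (hmono (Finset.subset_insert x F))
    -- Diminishing returns: `x` contributes at least as much over the smaller set `D i ∩ F` as over
    -- `F`.
    have hstep : ∀ i ∈ I, f (D i ∩ F) + (if x ∈ D i then f (insert x F) - f F else 0) ≤
        f (D i ∩ insert x F) := by
      intro i _
      split_ifs with hxi
      · have h := hsub (D i ∩ insert x F) F
        have e₁ : D i ∩ insert x F ∪ F = insert x F := by grind
        have e₂ : D i ∩ insert x F ∩ F = D i ∩ F := by grind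
        rw [e₁, e₂] at h
        linarith
      · rw [add_zero]
        exact hmono (Finset.inter_subset_inter_left (Finset.subset_insert x F))
    have hsum := Finset.sum_le_sum hstep
    rw [Finset.sum_add_distrib, ← Finset.sum_filter, Finset.sum_const, nsmul_eq_mul] at hsum
    have hcount : (k : ℝ) * (f (insert x F) - f F) ≤
        ((I.filter fun i => x ∈ D i).card : ℝ) * (f (insert x F) - f F) :=
      mul_le_mul_of_nonneg_right (by exact_mod_cast hk x (Finset.mem_insert_self x F)) hδ
    linarith

/-! ### Translates and trajectories -/

namespace CrossedProduct

variable {R : Type u} {G : Type v} [Ring R] [Group G] (c : CrossedSystem R G)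

theorem basis_mul_basis (g h : G) :
    basis c g * basis c h = ofRing c (c.ρ g h) * basis c (g * h) := by
  change single c g 1 * single c h 1 = single c 1 (c.ρ g h : R) * single c (g * h) 1
  rw [single_mul_single, single_mul_single]
  simp [c.σ_one, c.ρ_one_left]

theorem single_eq_basis_mul (g : G) (r : R) :
    single c g r = basis c g * ofRing c ((c.σ g).symm r) := by
  change _ = single c g 1 * single c 1 _
  rw [single_mul_single]
  simp [c.ρ_one_right]

end CrossedProduct

section Trajectory

variable {R : Type u} {G : Type v} [Ring R] [Group G] (c : CrossedSystem R G)
  {M : Type w} [AddCommGroup M] [Module (CrossedProduct c) M]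

theorem basisAction_one (m : RMod c M) : basisAction c M 1 m = m :=
  one_smul (CrossedProduct c) (show M from m)

theorem basisAction_basisAction (g h : G) (m : RMod c M) :
    basisAction c M g (basisAction c M h m) = (c.ρ g h : R) • basisAction c M (g * h) m := by
  change CrossedProduct.basis c g • (CrossedProduct.basis c h • (show M from m)) =
    CrossedProduct.ofRing c (c.ρ g h) • (CrossedProduct.basis c (g * h) • (show M from m))
  rw [smul_smul, smul_smul, CrossedProduct.basis_mul_basis]

/-- The product of u_{g⁻¹} and u_g is the unit ρ(g⁻¹, g) of `R`. -/
theorem basisAction_injective (g : G) : Function.Injective (basisAction c M g) := by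
  rw [injective_iff_map_eq_zero]
  intro m hm
  have h := basisAction_basisAction c g⁻¹ g m
  rw [hm, map_zero, inv_mul_cancel, basisAction_one] at h
  rw [← Units.smul_def] at h
  exact (smul_eq_zero_iff_eq _).1 h.symm

theorem translateSubmodule_one (K : Submodule R (RMod c M)) : translateSubmodule c 1 K = K := by
  ext x
  simp [translateSubmodule, basisAction_one]

/-- The cocycle contributes only a unit of `R`, which a submodule absorbs; on submodules the
translations therefore form a genuine action of `G`. -/
theorem translateSubmodule_translateSubmodule (g h : G) (K : Submodule R (RMod c M)) :
    translateSubmodule c g (translateSubmodule c h K) = translateSubmodule c (g * h) K := by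
  apply le_antisymm
  · rintro _ ⟨_, ⟨x, hx, rfl⟩, rfl⟩
    rw [basisAction_basisAction]
    exact Submodule.smul_mem _ _ ⟨x, hx, rfl⟩
  · rintro _ ⟨x, hx, rfl⟩
    have h' : basisAction c M (g * h) x =
        ((c.ρ g h)⁻¹ : Rˣ) • basisAction c M g (basisAction c M h x) := by
      rw [basisAction_basisAction, eq_inv_smul_iff, Units.smul_def]
    rw [h']
    exact Submodule.smul_mem _ _ ⟨_, ⟨x, hx, rfl⟩, rfl⟩

theorem translateSubmodule_mono (g : G) {H K : Submodule R (RMod c M)} (h : H ≤ K) :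
    translateSubmodule c g H ≤ translateSubmodule c g K :=
  Submodule.map_mono h

theorem translateSubmodule_le_trajectory {F : Finset G} {g : G} (hg : g ∈ F)
    (K : Submodule R (RMod c M)) : translateSubmodule c g K ≤ trajectory c F K :=
  le_iSup₂_of_le g hg le_rfl

theorem trajectory_le_iff {F : Finset G} {K H : Submodule R (RMod c M)} :
    trajectory c F K ≤ H ↔ ∀ g ∈ F, translateSubmodule c g K ≤ H :=
  iSup₂_le_iff

theorem trajectory_mono (F : Finset G) {H K : Submodule R (RMod c M)} (h : H ≤ K) :
    trajectory c F H ≤ trajectory c F K :=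
  iSup₂_mono fun g _ => translateSubmodule_mono c g h

theorem trajectory_subset {F F' : Finset G} (h : F ⊆ F') (K : Submodule R (RMod c M)) :
    trajectory c F K ≤ trajectory c F' K :=
  biSup_mono fun _ hg => h hg

@[simp]
theorem trajectory_empty (K : Submodule R (RMod c M)) : trajectory c ∅ K = ⊥ := by
  simp [trajectory]

theorem trajectory_singleton (g : G) (K : Submodule R (RMod c M)) :
    trajectory c {g} K = translateSubmodule c g K := by
  simp [trajectory]

theorem trajectory_union [DecidableEq G] (F F' : Finset G) (K : Submodule R (RMod c M)) :
    trajectory c (F ∪ F') K = trajectory c F K ⊔ trajectory c F' K :=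
  Finset.iSup_union

theorem trajectory_insert [DecidableEq G] (g : G) (F : Finset G) (K : Submodule R (RMod c M)) :
    trajectory c (insert g F) K = translateSubmodule c g K ⊔ trajectory c F K :=
  Finset.iSup_insert _ _ _

theorem translateSubmodule_trajectory [DecidableEq G] (g : G) (F : Finset G)
    (K : Submodule R (RMod c M)) :
    translateSubmodule c g (trajectory c F K) = trajectory c (F.image (g * ·)) K := by
  rw [trajectory, trajectory, Finset.iSup_finset_image]
  simp only [translateSubmodule, Submodule.map_iSup]
  refine iSup_congr fun h => iSup_congr fun _ => translateSubmodule_translateSubmodule c g h K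

theorem trajectory_trajectory_le [DecidableEq G] (F C : Finset G) (K : Submodule R (RMod c M)) :
    trajectory c F (trajectory c C K) ≤
      trajectory c (Finset.image₂ (· * ·) F C) K := by
  rw [trajectory_le_iff]
  intro g hg
  rw [translateSubmodule_trajectory]
  refine trajectory_subset c (fun x hx => ?_) K
  obtain ⟨h, hh, rfl⟩ := Finset.mem_image.1 hx
  exact Finset.mem_image₂_of_mem hg hh

variable {N : Type w} [AddCommGroup N] [Module (CrossedProduct c) N]

/-- A linear map over `R * G`, seen as a linear map over `R`. -/
noncomputable def resMap (f : M →ₗ[CrossedProduct c] N) : RMod c M →ₗ[R] RMod c N where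
  toFun := f
  map_add' := f.map_add
  map_smul' := fun r m => f.map_smul (CrossedProduct.ofRing c r) m

theorem map_translateSubmodule (f : M →ₗ[CrossedProduct c] N) (g : G)
    (K : Submodule R (RMod c M)) :
    (translateSubmodule c g K).map (resMap c f) = translateSubmodule c g (K.map (resMap c f)) := by
  have h : ∀ x : RMod c M, resMap c f (basisAction c M g x) = basisAction c N g (resMap c f x) :=
    fun x => f.map_smul (CrossedProduct.basis c g) x
  apply le_antisymm
  · rintro _ ⟨_, ⟨x, hx, rfl⟩, rfl⟩
    exact ⟨_, ⟨x, hx, rfl⟩, (h x).symm⟩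
  · rintro _ ⟨_, ⟨x, hx, rfl⟩, rfl⟩
    exact ⟨_, ⟨x, hx, rfl⟩, h x⟩

theorem map_trajectory (f : M →ₗ[CrossedProduct c] N) (F : Finset G)
    (K : Submodule R (RMod c M)) :
    (trajectory c F K).map (resMap c f) = trajectory c F (K.map (resMap c f)) := by
  simp only [trajectory, Submodule.map_iSup, map_translateSubmodule]

end Trajectory

/-! ### Lengths of trajectories -/

section Length

variable {R : Type u} {G : Type v} [Ring R] [Group G] {c : CrossedSystem R G}
  {L : ModuleInvariant.{u, w} R}

/-- A σ(g)-semilinear injection is an `R`-linear isomorphism onto its image with scalars restricted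
along σ(g). This makes `L` invariant under translation by u_g. -/
theorem IsCompatibleWith.map_semilinear (hLc : IsCompatibleWith c L) (hL : IsLengthFunction L)
    {M N : Type w} [AddCommGroup M] [Module R M] [AddCommGroup N] [Module R N] (g : G)
    (f : M →ₛₗ[(c.σ g : R →+* R)] N) (hf : Function.Injective f) (K : Submodule R M) :
    L (K.map f) = L K := by
  let φ : K →ₗ[R] ResScalars (c.σ g : R →+* R) (K.map f) :=
    { toFun := fun k => (⟨f k, Submodule.mem_map_of_mem k.2⟩ : K.map f)
      map_add' := fun x y => Subtype.ext (f.map_add x y)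
      map_smul' := fun r x => Subtype.ext (f.map_smulₛₗ r x) }
  have hφ : Function.Bijective φ := by
    constructor
    · intro x y h
      exact Subtype.ext (hf (congrArg Subtype.val h))
    · rintro ⟨_, x, hx, rfl⟩
      exact ⟨⟨x, hx⟩, rfl⟩
  rw [← hLc g (K.map f)]
  exact (hL.congr (LinearEquiv.ofBijective φ hφ)).symm

variable {M : Type w} [AddCommGroup M] [Module (CrossedProduct c) M]

theorem length_translateSubmodule (hL : IsLengthFunction L) (hLc : IsCompatibleWith c L) (g : G)
    (K : Submodule R (RMod c M)) : L (translateSubmodule c g K) = L K :=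
  hLc.map_semilinear hL g _ (basisAction_injective c g) K

theorem length_trajectory_le (hL : IsLengthFunction L) (hLc : IsCompatibleWith c L) (F : Finset G)
    (K : Submodule R (RMod c M)) : L (trajectory c F K) ≤ F.card * L K := by
  classical
  induction F using Finset.induction_on with
  | empty => rw [trajectory_empty, hL.bot]; exact zero_le
  | insert g F hg ih =>
    rw [trajectory_insert, Finset.card_insert_of_notMem hg]
    refine (hL.sup_le _ _).trans ?_
    rw [length_translateSubmodule hL hLc, Nat.cast_add, add_mul, Nat.cast_one, one_mul, add_comm]
    exact add_le_add_left ih _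

theorem length_trajectory_ne_top (hL : IsLengthFunction L) (hLc : IsCompatibleWith c L)
    (F : Finset G) {K : Submodule R (RMod c M)} (hK : L K ≠ ∞) : L (trajectory c F K) ≠ ∞ :=
  ne_top_of_le_ne_top (ENNReal.mul_ne_top (ENNReal.natCast_ne_top _) hK)
    (length_trajectory_le hL hLc F K)

/-- Comparison of the trajectory of `K` with that of a submodule `H` of `∑_{d ∈ D} u_d K`. -/
theorem length_trajectory_interior_le [DecidableEq G] (hL : IsLengthFunction L)
    (hLc : IsCompatibleWith c L)
    {H K : Submodule R (RMod c M)} (hK : L K ≠ ∞) {D : Finset G} (hH : H ≤ trajectory c D K)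
    (F : Finset G) :
    D.card * L (trajectory c (F.filter fun x => ∀ d ∈ D, x * d⁻¹ ∈ F) K) + F.card * L H ≤
      D.card * L (trajectory c F H) + F.card * L (trajectory c D K) := by
  have hT : ∀ S, L (trajectory c S K) ≠ ∞ := fun S => length_trajectory_ne_top hL hLc S hK
  have hHt : L H ≠ ∞ := ne_top_of_le_ne_top (hT D) (hL.mono hH)
  set B := trajectory c F H with hB_def
  have hB : L B ≠ ∞ := length_trajectory_ne_top hL hLc F hHt
  have hTB : ∀ S, L (trajectory c S K ⊔ B : Submodule R (RMod c M)) ≠ ∞ :=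
    fun S => hL.sup_ne_top (hT S) hB
  set Fi := F.filter fun x => ∀ d ∈ D, x * d⁻¹ ∈ F
  -- The length of T_S(K) modulo `B`. Real values permit the subtractions, as all the lengths
  -- involved are finite.
  let f : Finset G → ℝ := fun S =>
    (L (trajectory c S K ⊔ B : Submodule R (RMod c M))).toReal - (L B).toReal
  have h₀ : f ∅ = 0 := by
    simp only [f]
    rw [trajectory_empty, bot_sup_eq, sub_self]
  have hmono : ∀ ⦃S T⦄, S ⊆ T → f S ≤ f T := fun S T h =>
    sub_le_sub_right (ENNReal.toReal_mono (hTB T)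
      (hL.mono (sup_le_sup_right (trajectory_subset c h K) B))) _
  have hsub : ∀ S T, f (S ∪ T) + f (S ∩ T) ≤ f S + f T := by
    intro S T
    have h := hL.sup_add_inf (trajectory c S K ⊔ B) (trajectory c T K ⊔ B)
    rw [← sup_sup_distrib_right, ← trajectory_union] at h
    -- Only an inclusion holds between the trajectory over `S ∩ T` and the intersection of the
    -- trajectories; hence submodularity rather than modularity.
    have h' : L (trajectory c (S ∩ T) K ⊔ B : Submodule R (RMod c M)) ≤
        L ((trajectory c S K ⊔ B) ⊓ (trajectory c T K ⊔ B) : Submodule R (RMod c M)) :=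
      hL.mono (le_inf (sup_le_sup_right (trajectory_subset c Finset.inter_subset_left K) B)
        (sup_le_sup_right (trajectory_subset c Finset.inter_subset_right K) B))
    have h'' := (add_le_add_right h' (L (trajectory c (S ∪ T) K ⊔ B : Submodule R _))).trans h.le
    have := ENNReal.toReal_mono (ENNReal.add_ne_top.2 ⟨hTB S, hTB T⟩) h''
    rw [ENNReal.toReal_add (hTB _) (hTB _), ENNReal.toReal_add (hTB _) (hTB _)] at this
    simp only [f]
    linarith
  -- A point `x` lies in gD for every g = x d⁻¹ with d ∈ D; `Fi` consists of the points of `F` for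
  -- which all these g belong to `F`.
  have hcover : ∀ x ∈ Fi, D.card ≤ (F.filter fun g => x ∈ D.image (g * ·)).card := by
    intro x hx
    refine Finset.card_le_card_of_injOn (fun d => x * d⁻¹) (fun d hd => ?_) (by
      intro a _ b _ h
      simpa using h)
    simp only [Finset.coe_filter, Set.mem_ofPred_eq, Finset.mem_image]
    exact ⟨(Finset.mem_filter.1 hx).2 d hd, d, hd, by simp⟩
  have hshearer := mul_le_sum_of_submodular h₀ hmono hsub F (fun g => D.image (g * ·)) D.card Fi
    hcover
  -- The translate u_g H lies both in u_g T_D(K) and in `B`, so the quotient by `B` kills at least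
  -- L(H).
  have hterm : ∀ g ∈ F, f (D.image (g * ·)) ≤ (L (trajectory c D K)).toReal - (L H).toReal := by
    intro g hg
    simp only [f]
    rw [← translateSubmodule_trajectory]
    have h := hL.sup_add_inf (translateSubmodule c g (trajectory c D K)) B
    rw [length_translateSubmodule hL hLc] at h
    have h' : L H ≤ L (translateSubmodule c g (trajectory c D K) ⊓ B : Submodule R (RMod c M)) := by
      rw [← length_translateSubmodule hL hLc g H]
      exact hL.mono (le_inf (translateSubmodule_mono c g hH)
        (translateSubmodule_le_trajectory c hg H))
    have hfin : L (translateSubmodule c g (trajectory c D K) ⊔ B : Submodule R (RMod c M)) ≠ ∞ :=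
      hL.sup_ne_top (by rw [length_translateSubmodule hL hLc]; exact hT D) hB
    have h'' := (add_le_add_right h'
      (L (translateSubmodule c g (trajectory c D K) ⊔ B : Submodule R _))).trans h.le
    have := ENNReal.toReal_mono (ENNReal.add_ne_top.2 ⟨hT D, hB⟩) h''
    rw [ENNReal.toReal_add hfin hHt, ENNReal.toReal_add (hT D) hB] at this
    linarith
  have hsum := hshearer.trans (Finset.sum_le_sum hterm)
  rw [Finset.sum_const, nsmul_eq_mul] at hsum
  have hle : (L (trajectory c Fi K)).toReal ≤ f Fi + (L B).toReal := by
    simp only [f, sub_add_cancel]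
    exact ENNReal.toReal_mono (hTB Fi) (hL.mono le_sup_left)
  have hle' := mul_le_mul_of_nonneg_left hle (Nat.cast_nonneg (α := ℝ) D.card)
  have hn := fun n : ℕ => ENNReal.natCast_ne_top n
  rw [← ENNReal.toReal_le_toReal
      (ENNReal.add_ne_top.2 ⟨ENNReal.mul_ne_top (hn _) (hT _), ENNReal.mul_ne_top (hn _) hHt⟩)
      (ENNReal.add_ne_top.2 ⟨ENNReal.mul_ne_top (hn _) hB, ENNReal.mul_ne_top (hn _) (hT _)⟩),
    ENNReal.toReal_add (ENNReal.mul_ne_top (hn _) (hT _)) (ENNReal.mul_ne_top (hn _) hHt),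
    ENNReal.toReal_add (ENNReal.mul_ne_top (hn _) hB) (ENNReal.mul_ne_top (hn _) (hT _))]
  simp only [ENNReal.toReal_mul, ENNReal.toReal_natCast]
  linarith

end Length

/-! ### Følner sequences -/

section Folner

variable {G : Type v} [Group G]

theorem cBoundary_mono {C C' : Set G} (h : C ⊆ C') (A : Set G) :
    cBoundary C A ⊆ cBoundary C' A := by
  rintro x ⟨⟨y, hy, hxy⟩, hx⟩
  exact ⟨⟨y, h hy, hxy⟩, fun hx' => hx fun z hz => hx' z (h hz)⟩

theorem cBoundary_finite (C A : Finset G) : (cBoundary (C : Set G) (A : Set G)).Finite := by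
  classical
  refine (Finset.image₂ (fun a y => a * y⁻¹) A C).finite_toSet.subset ?_
  rintro x ⟨⟨y, hy, hxy⟩, -⟩
  exact Finset.mem_coe.2 (Finset.mem_image₂.2 ⟨x * y, hxy, y, hy, by simp⟩)

/-- Finite generation makes `G` countable, hence an increasing union of finite sets `E n`. A member
of the net whose relative `E n`-boundary is below 1/(n+1) serves as the n-th term, because
boundaries grow with `C` and every `C` is eventually contained in `E n`. -/
theorem IsAmenable.exists_folnerSeq [Group.FG G] (hG : IsAmenable G) :
    ∃ F : ℕ → Finset G, IsFolnerSeq F := by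
  classical
  obtain ⟨I, _, _, _, F, hne, hF⟩ := hG
  obtain ⟨S, _, φ, hφ⟩ := Group.fg_iff_exists_freeGroup_hom_surjective_finite.1 ‹Group.FG G›
  have : Countable G := hφ.countable
  obtain ⟨e, he⟩ := exists_surjective_nat G
  let E : ℕ → Finset G := fun n => (Finset.range (n + 1)).image e
  have hsmall : ∀ n : ℕ, ∃ i, ((cBoundary (E n : Set G) (F i : Set G)).ncard : ℝ) / (F i).card <
      1 / ((n : ℝ) + 1) := fun n =>
    ((hF (E n)).eventually (gt_mem_nhds (Nat.one_div_pos_of_nat (α := ℝ)))).exists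
  choose i hi using hsmall
  refine ⟨fun n => F (i n), fun n => hne _, fun C => ?_⟩
  obtain ⟨m, hm⟩ : ∃ m, C ⊆ E m := by
    choose k hk using he
    refine ⟨C.sup k, fun x hx => Finset.mem_image.2 ⟨k x, ?_, hk x⟩⟩
    exact Finset.mem_range.2 (Nat.lt_succ_of_le (Finset.le_sup hx))
  refine squeeze_zero' (Filter.Eventually.of_forall fun n => by positivity) ?_
    tendsto_one_div_add_atTop_nhds_zero_nat
  filter_upwards [Filter.eventually_ge_atTop m] with n hn
  refine le_trans ?_ (hi n).le
  gcongr
  · exact cBoundary_finite _ _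
  · refine cBoundary_mono ?_ _
    refine Finset.coe_subset.2 (hm.trans (Finset.image_subset_image ?_))
    exact Finset.range_mono (by omega)

/-- The relative size of the `C`-boundary of `A`. -/
noncomputable def boundaryRatio (C A : Finset G) : ℝ≥0∞ :=
  ((cBoundary (C : Set G) (A : Set G)).ncard : ℝ≥0∞) / (A.card : ℝ≥0∞)

theorem IsFolnerSeq.tendsto_boundaryRatio {F : ℕ → Finset G} (hF : IsFolnerSeq F) (C : Finset G) :
    Filter.Tendsto (fun n => boundaryRatio C (F n)) Filter.atTop (𝓝 0) := by
  have h := ENNReal.tendsto_ofReal (hF.2 C)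
  rw [ENNReal.ofReal_zero] at h
  refine h.congr fun n => ?_
  rw [ENNReal.ofReal_div_of_pos (by exact_mod_cast (hF.1 n).card_pos), ENNReal.ofReal_natCast,
    ENNReal.ofReal_natCast, boundaryRatio]

/-- If x ∈ F and some x d⁻¹ leaves `F`, then 1 puts `x` in the exterior and d⁻¹ keeps it out of the
interior. -/
theorem card_sdiff_interior_le [DecidableEq G] (D F : Finset G) :
    (F \ F.filter fun x => ∀ d ∈ D, x * d⁻¹ ∈ F).card ≤
      (cBoundary ((insert 1 (D.image (·⁻¹)) : Finset G) : Set G) (F : Set G)).ncard := by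
  rw [← Set.ncard_coe_finset]
  refine Set.ncard_le_ncard (fun x hx => ?_) (cBoundary_finite _ _)
  obtain ⟨hxF, hx⟩ := Finset.mem_sdiff.1 (Finset.mem_coe.1 hx)
  refine ⟨⟨1, by simp, by simpa using hxF⟩, fun h => hx (Finset.mem_filter.2 ⟨hxF, ?_⟩)⟩
  exact fun d hd => h d⁻¹ (by simp [hd])

/-- The roles are reversed: for x = fd outside `F`, d⁻¹ leads back into `F` and 1 witnesses that `x`
is not interior. -/
theorem card_mul_sdiff_le [DecidableEq G] (F C : Finset G) :
    (Finset.image₂ (· * ·) F C \ F).card ≤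
      (cBoundary ((insert 1 (C.image (·⁻¹)) : Finset G) : Set G) (F : Set G)).ncard := by
  rw [← Set.ncard_coe_finset]
  refine Set.ncard_le_ncard (fun x hx => ?_) (cBoundary_finite _ _)
  obtain ⟨hx, hxF⟩ := Finset.mem_sdiff.1 (Finset.mem_coe.1 hx)
  obtain ⟨f, hf, d, hd, rfl⟩ := Finset.mem_image₂.1 hx
  refine ⟨⟨d⁻¹, by simp [hd], by simpa using hf⟩, fun h => hxF ?_⟩
  simpa using h 1 (by simp)

end Folner

/-! ### The entropy as an infimum -/

section EntropyInf

variable {R : Type u} {G : Type v} [Ring R] [Group G] {c : CrossedSystem R G}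
  {L : ModuleInvariant.{u, w} R} {M : Type w} [AddCommGroup M] [Module (CrossedProduct c) M]

variable (c L) in
/-- The infimum over all non-empty finite `D ⊆ G` of `L(T_D(K)) / |D|`. -/
noncomputable def entropyInf (K : Submodule R (RMod c M)) : ℝ≥0∞ :=
  ⨅ D : {D : Finset G // D.Nonempty}, L (trajectory c D.1 K) / (D.1.card : ℝ≥0∞)

theorem entropyInf_le (K : Submodule R (RMod c M)) {D : Finset G} (hD : D.Nonempty) :
    entropyInf c L K ≤ L (trajectory c D K) / (D.card : ℝ≥0∞) :=
  iInf_le (fun D : {D : Finset G // D.Nonempty} => L (trajectory c D.1 K) / (D.1.card : ℝ≥0∞))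
    ⟨D, hD⟩

theorem entropyInf_mono (hL : IsLengthFunction L) {H K : Submodule R (RMod c M)} (h : H ≤ K) :
    entropyInf c L H ≤ entropyInf c L K :=
  iInf_mono fun D => ENNReal.div_le_div_right (hL.mono (trajectory_mono c D.1 h)) _

theorem entropyInf_le_length (K : Submodule R (RMod c M)) : entropyInf c L K ≤ L K := by
  refine (entropyInf_le K (Finset.singleton_nonempty 1)).trans ?_
  rw [trajectory_singleton, translateSubmodule_one, Finset.card_singleton, Nat.cast_one, div_one]

theorem entropyInf_map {N : Type w} [AddCommGroup N] [Module (CrossedProduct c) N]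
    (hL : IsLengthFunction L) {f : M →ₗ[CrossedProduct c] N} (hf : Function.Injective f)
    (K : Submodule R (RMod c M)) : entropyInf c L (K.map (resMap c f)) = entropyInf c L K := by
  refine iInf_congr fun D => ?_
  rw [← map_trajectory, hL.map_of_injective (f := resMap c f) hf]

theorem div_natCast_eq {a b : ℕ} (ha : a ≠ 0) (x : ℝ≥0∞) :
    x / b = a * x / (a * b) := by
  rw [ENNReal.mul_div_mul_left _ _ (by exact_mod_cast ha) (ENNReal.natCast_ne_top a)]

/-- This is `length_trajectory_interior_le` divided by |D||F n|, after restoring the non-interior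
points of `F n`; each of them costs at most L(K). -/
theorem entropyTerm_add_le (hL : IsLengthFunction L) (hLc : IsCompatibleWith c L)
    [DecidableEq G] {F : ℕ → Finset G} (hF : IsFolnerSeq F) {H K : Submodule R (RMod c M)}
    (hK : L K ≠ ∞) {D : Finset G} (hD : D.Nonempty) (hH : H ≤ trajectory c D K) (n : ℕ) :
    entropyTerm c L F K n + L H / (D.card : ℝ≥0∞) ≤
      entropyTerm c L F H n + L (trajectory c D K) / (D.card : ℝ≥0∞) +
        boundaryRatio (insert 1 (D.image (·⁻¹))) (F n) * L K := by
  let b := (cBoundary ((insert 1 (D.image (·⁻¹)) : Finset G) : Set G) (F n : Set G)).ncard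
  set Fi := (F n).filter fun x => ∀ d ∈ D, x * d⁻¹ ∈ F n
  have h₁ : L (trajectory c (F n) K) ≤ L (trajectory c Fi K) + b * L K := by
    conv_lhs => rw [← Finset.union_sdiff_of_subset (Finset.filter_subset _ (F n) : Fi ⊆ F n)]
    rw [trajectory_union]
    refine (hL.sup_le _ _).trans (add_le_add_right ?_ _)
    refine (length_trajectory_le hL hLc _ K).trans (mul_le_mul_left ?_ _)
    exact_mod_cast card_sdiff_interior_le D (F n)
  have h₂ := length_trajectory_interior_le hL hLc hK hH (F n)
  have h₃ : D.card * L (trajectory c (F n) K) + (F n).card * L H ≤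
      D.card * L (trajectory c (F n) H) + (F n).card * L (trajectory c D K) +
        D.card * (b * L K) :=
    calc _ ≤ D.card * (L (trajectory c Fi K) + b * L K) + (F n).card * L H := by gcongr
      _ = (D.card * L (trajectory c Fi K) + (F n).card * L H) + D.card * (b * L K) := by ring
      _ ≤ _ := by gcongr
  have hd : D.card ≠ 0 := hD.card_ne_zero
  have hf : (F n).card ≠ 0 := (hF.1 n).card_ne_zero
  have h₄ := ENNReal.div_le_div_right h₃ ((D.card : ℝ≥0∞) * (F n).card)
  rw [entropyTerm, entropyTerm, boundaryRatio, ENNReal.mul_comm_div, ← mul_div_assoc,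
    div_natCast_eq hd, div_natCast_eq hd (L (trajectory c (F n) H)),
    div_natCast_eq hd (b * L K), div_natCast_eq hf, div_natCast_eq hf (L (trajectory c D K)),
    mul_comm ((F n).card : ℝ≥0∞) (D.card : ℝ≥0∞)]
  simpa only [ENNReal.add_div] using h₄

/-- No term is below the infimum, as `F n` is itself a competitor. Conversely, the case H = ⊥ of
`entropyTerm_add_le` bounds the terms by the quotient of any `D`, up to a vanishing boundary term.
-/
theorem tendsto_entropyTerm (hL : IsLengthFunction L) (hLc : IsCompatibleWith c L)
    {F : ℕ → Finset G} (hF : IsFolnerSeq F) {K : Submodule R (RMod c M)} (hK : L K ≠ ∞) :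
    Filter.Tendsto (entropyTerm c L F K) Filter.atTop (𝓝 (entropyInf c L K)) := by
  classical
  refine tendsto_order.2 ⟨fun a ha => Filter.Eventually.of_forall fun n =>
    ha.trans_le (entropyInf_le K (hF.1 n)), fun a ha => ?_⟩
  obtain ⟨⟨D, hD⟩, hDa⟩ := iInf_lt_iff.1 ha
  have hlim : Filter.Tendsto (fun n => L (trajectory c D K) / (D.card : ℝ≥0∞) +
      boundaryRatio (insert 1 (D.image (·⁻¹))) (F n) * L K) Filter.atTop
      (𝓝 (L (trajectory c D K) / (D.card : ℝ≥0∞) + 0 * L K)) :=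
    tendsto_const_nhds.add
      (ENNReal.Tendsto.mul_const (hF.tendsto_boundaryRatio _) (Or.inr hK))
  rw [zero_mul, add_zero] at hlim
  filter_upwards [hlim.eventually (gt_mem_nhds hDa)] with n hn
  refine lt_of_le_of_lt ?_ hn
  have h := entropyTerm_add_le hL hLc hF hK hD bot_le n
  have h₀ : entropyTerm c L F (⊥ : Submodule R (RMod c M)) n = 0 := by
    refine le_antisymm ((ENNReal.div_le_div_right (length_trajectory_le hL hLc (F n) _) _).trans ?_)
      zero_le
    rw [hL.bot, mul_zero, ENNReal.zero_div]
  rwa [hL.bot, ENNReal.zero_div, add_zero, h₀, zero_add] at h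

theorem entropyAt_eq (hL : IsLengthFunction L) (hLc : IsCompatibleWith c L)
    {F : ℕ → Finset G} (hF : IsFolnerSeq F) {K : Submodule R (RMod c M)} (hK : L K ≠ ∞) :
    entropyAt c L F K = entropyInf c L K :=
  (tendsto_entropyTerm hL hLc hF hK).limUnder_eq

/-- The limit of `entropyTerm_add_le` along the Følner sequence. It says that enlarging H to T_D(K)
costs, per element of `D`, at least as much length as the entropy gained in passing from H to K. -/
theorem entropyInf_add_le (hL : IsLengthFunction L) (hLc : IsCompatibleWith c L)
    {F : ℕ → Finset G} (hF : IsFolnerSeq F) {H K : Submodule R (RMod c M)} (hK : L K ≠ ∞)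
    {D : Finset G} (hD : D.Nonempty) (hH : H ≤ trajectory c D K) :
    entropyInf c L K + L H / (D.card : ℝ≥0∞) ≤
      entropyInf c L H + L (trajectory c D K) / (D.card : ℝ≥0∞) := by
  classical
  have hHt : L H ≠ ∞ :=
    ne_top_of_le_ne_top (length_trajectory_ne_top hL hLc D hK) (hL.mono hH)
  have hlim := ((tendsto_entropyTerm hL hLc hF hHt).add
    (tendsto_const_nhds (x := L (trajectory c D K) / (D.card : ℝ≥0∞)))).add
    (ENNReal.Tendsto.mul_const (b := L K)
      (hF.tendsto_boundaryRatio (insert 1 (D.image (·⁻¹)))) (Or.inr hK))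
  rw [zero_mul, add_zero] at hlim
  exact le_of_tendsto_of_tendsto'
    ((tendsto_entropyTerm hL hLc hF hK).add tendsto_const_nhds) hlim
    (entropyTerm_add_le hL hLc hF hK hD hH)

theorem entropyInf_eq_of_length_eq (hL : IsLengthFunction L) (hLc : IsCompatibleWith c L)
    {F : ℕ → Finset G} (hF : IsFolnerSeq F) {H K : Submodule R (RMod c M)} (hK : L K ≠ ∞)
    (hHK : H ≤ K) (h : L H = L K) : entropyInf c L H = entropyInf c L K := by
  refine le_antisymm (entropyInf_mono hL hHK) ?_
  have h₁ : trajectory c {1} K = K := by rw [trajectory_singleton, translateSubmodule_one]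
  have h₂ := entropyInf_add_le hL hLc hF hK (Finset.singleton_nonempty 1) (hHK.trans h₁.ge)
  rw [h₁, h, Finset.card_singleton, Nat.cast_one, div_one] at h₂
  exact (ENNReal.add_le_add_iff_right hK).1 h₂

theorem algEntropy_eq (hL : IsLengthFunction L) (hLc : IsCompatibleWith c L)
    {F : ℕ → Finset G} (hF : IsFolnerSeq F) (M : Type w) [AddCommGroup M]
    [Module (CrossedProduct c) M] :
    algEntropy c L F M = ⨆ (K : Submodule R (RMod c M)) (_ : L K ≠ ∞), entropyInf c L K :=
  iSup_congr fun _ => iSup_congr fun hK => entropyAt_eq hL hLc hF hK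

theorem entropyInf_le_algEntropy (hL : IsLengthFunction L) (hLc : IsCompatibleWith c L)
    {F : ℕ → Finset G} (hF : IsFolnerSeq F) {K : Submodule R (RMod c M)} (hK : L K ≠ ∞) :
    entropyInf c L K ≤ algEntropy c L F M := by
  rw [algEntropy_eq hL hLc hF]
  exact le_iSup₂_of_le K hK le_rfl

theorem algEntropy_le (hL : IsLengthFunction L) (hLc : IsCompatibleWith c L)
    {F : ℕ → Finset G} (hF : IsFolnerSeq F) {a : ℝ≥0∞}
    (h : ∀ K : Submodule R (RMod c M), L K ≠ ∞ → entropyInf c L K ≤ a) :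
    algEntropy c L F M ≤ a := by
  rw [algEntropy_eq hL hLc hF]
  exact iSup₂_le h

/-- For a discrete length function, the finitely generated submodules suffice to compute the
entropy. -/
theorem algEntropy_le_of_fg (hL : IsLengthFunction L) (hLd : IsDiscreteInvariant L)
    (hLc : IsCompatibleWith c L) {F : ℕ → Finset G} (hF : IsFolnerSeq F) {a : ℝ≥0∞}
    (h : ∀ K : Submodule R (RMod c M), K.FG → L K ≠ ∞ → entropyInf c L K ≤ a) :
    algEntropy c L F M ≤ a := by
  refine algEntropy_le hL hLc hF fun K hK => ?_
  obtain ⟨H, hHK, hfg, hH⟩ := hL.exists_fg_le_eq hLd hK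
  rw [← entropyInf_eq_of_length_eq hL hLc hF hK hHK hH]
  exact h H hfg (hH ▸ hK)

theorem algEntropy_le_of_injective {N : Type w} [AddCommGroup N] [Module (CrossedProduct c) N]
    (hL : IsLengthFunction L) (hLc : IsCompatibleWith c L) {F : ℕ → Finset G} (hF : IsFolnerSeq F)
    {f : N →ₗ[CrossedProduct c] M} (hf : Function.Injective f) :
    algEntropy c L F N ≤ algEntropy c L F M := by
  refine algEntropy_le hL hLc hF fun K hK => ?_
  rw [← entropyInf_map hL hf]
  exact entropyInf_le_algEntropy hL hLc hF
    (by rwa [hL.map_of_injective (f := resMap c f) hf])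

end EntropyInf

/-! ### Upper continuity and additivity of the entropy -/

theorem Submodule.FG.exists_le_of_directed {A M ι : Type*} [Ring A] [AddCommGroup M] [Module A M]
    [Nonempty ι] {T : ι → Submodule A M} (hT : Directed (· ≤ ·) T) {K : Submodule A M}
    (hK : K.FG) (h : ∀ x ∈ K, ∃ i, x ∈ T i) : ∃ i, K ≤ T i := by
  classical
  obtain ⟨s, rfl⟩ := hK
  have : ∀ t : Finset M, t ⊆ s → ∃ i, (t : Set M) ⊆ T i := by
    intro t
    induction t using Finset.induction_on with
    | empty => exact fun _ => ⟨Classical.arbitrary ι, by simp⟩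
    | insert x t _ ih =>
      intro hs
      obtain ⟨i, hi⟩ := ih ((Finset.subset_insert x t).trans hs)
      obtain ⟨j, hj⟩ := h x (Submodule.subset_span (hs (Finset.mem_insert_self x t)))
      obtain ⟨k, hik, hjk⟩ := hT i j
      refine ⟨k, ?_⟩
      rw [Finset.coe_insert]
      exact Set.insert_subset (hjk hj) (hi.trans hik)
  obtain ⟨i, hi⟩ := this s subset_rfl
  exact ⟨i, Submodule.span_le.2 hi⟩

theorem Submodule.FG.exists_map_eq {A M N : Type*} [Ring A] [AddCommGroup M] [Module A M]
    [AddCommGroup N] [Module A N] {g : M →ₗ[A] N} (hg : Function.Surjective g)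
    {K : Submodule A N} (hK : K.FG) : ∃ H : Submodule A M, H.FG ∧ H.map g = K := by
  classical
  obtain ⟨s, rfl⟩ := hK
  refine ⟨Submodule.span A (s.image (Function.surjInv hg)), ⟨_, rfl⟩, ?_⟩
  rw [Submodule.map_span, Finset.coe_image, Set.image_image]
  simp [Function.surjInv_eq hg]

section Properties

variable {R : Type u} {G : Type v} [Ring R] [Group G] {c : CrossedSystem R G}
  {L : ModuleInvariant.{u, w} R}

theorem resMap_injective {M N : Type w} [AddCommGroup M] [Module (CrossedProduct c) M]
    [AddCommGroup N] [Module (CrossedProduct c) N] {f : M →ₗ[CrossedProduct c] N}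
    (hf : Function.Injective f) : Function.Injective (resMap c f) :=
  hf

theorem algEntropy_isInvariantOn (hL : IsLengthFunction L) (hLc : IsCompatibleWith c L)
    {F : ℕ → Finset G} (hF : IsFolnerSeq F) (C : ModuleClass.{max u v, w} (CrossedProduct c)) :
    IsInvariantOn C (algEntropy c L F) := by
  rintro M N _ _ _ _ - - ⟨e⟩
  exact le_antisymm (algEntropy_le_of_injective hL hLc hF (f := e.toLinearMap) e.injective)
    (algEntropy_le_of_injective hL hLc hF (f := e.symm.toLinearMap) e.symm.injective)

theorem algEntropy_isUpperContinuousOn (hL : IsLengthFunction L) (hLd : IsDiscreteInvariant L)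
    (hLc : IsCompatibleWith c L) {F : ℕ → Finset G} (hF : IsFolnerSeq F)
    (C : ModuleClass.{max u v, w} (CrossedProduct c)) :
    IsUpperContinuousOn C (algEntropy c L F) := by
  intro M _ _ _ S hne hS htop
  have hsub : ∀ N : Submodule (CrossedProduct c) M, Function.Injective N.subtype :=
    fun N => N.injective_subtype
  refine le_antisymm (algEntropy_le_of_fg hL hLd hLc hF fun K hfg hK => ?_)
    (iSup₂_le fun N _ => algEntropy_le_of_injective hL hLc hF (hsub N))
  have : Nonempty S := hne.to_subtype
  -- `K` is finitely generated over `R` only, so the members of `S` are compared with it through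
  -- their underlying `R`-submodules.
  obtain ⟨⟨N, hN⟩, hKN⟩ := hfg.exists_le_of_directed
    (T := fun N : S => LinearMap.range (resMap c N.1.subtype)) (fun N N' => by
      obtain ⟨P, hP, h, h'⟩ := hS N.1 N.2 N'.1 N'.2
      refine ⟨⟨P, hP⟩, ?_, ?_⟩
      · rintro _ ⟨x, rfl⟩
        exact ⟨Submodule.inclusion h x, rfl⟩
      · rintro _ ⟨x, rfl⟩
        exact ⟨Submodule.inclusion h' x, rfl⟩) (fun x _ => by
      have hx : (show M from x) ∈ sSup S := htop ▸ Submodule.mem_top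
      obtain ⟨N, hN, hxN⟩ := (Submodule.mem_sSup_of_directed hne hS).1 hx
      exact ⟨⟨N, hN⟩, ⟨_, hxN⟩, rfl⟩)
  have hK' := Submodule.map_comap_eq_self hKN
  rw [← hK', entropyInf_map hL (hsub N)]
  refine le_trans (entropyInf_le_algEntropy hL hLc hF ?_)
    (le_iSup₂_of_le (f := fun N (_ : N ∈ S) => algEntropy c L F N) N hN le_rfl)
  rw [← hL.map_of_injective (resMap_injective (hsub N)), hK']
  exact hK

variable {N M P : Type w} [AddCommGroup N] [Module (CrossedProduct c) N] [AddCommGroup M]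
  [Module (CrossedProduct c) M] [AddCommGroup P] [Module (CrossedProduct c) P]
  {f : N →ₗ[CrossedProduct c] M} {g : M →ₗ[CrossedProduct c] P}

theorem length_inf_range_add_map (hL : IsLengthFunction L) (hfg : Function.Exact f g)
    (K : Submodule R (RMod c M)) :
    L K = L (K ⊓ LinearMap.range (resMap c f) : Submodule R (RMod c M)) +
      L (K.map (resMap c g)) := by
  rw [show LinearMap.range (resMap c f) = LinearMap.ker (resMap c g) from
    SetLike.ext fun x => (hfg x).symm]
  exact hL.inf_ker_add_map (resMap c g) K

theorem algEntropy_le_add (hL : IsLengthFunction L) (hLc : IsCompatibleWith c L)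
    {F : ℕ → Finset G} (hF : IsFolnerSeq F) (hf : Function.Injective f)
    (hfg : Function.Exact f g) :
    algEntropy c L F M ≤ algEntropy c L F N + algEntropy c L F P := by
  refine algEntropy_le hL hLc hF fun K hK => ?_
  have hgK : L (K.map (resMap c g)) ≠ ∞ := ne_top_of_le_ne_top hK (hL.map_le _ _)
  refine le_trans ?_ (add_le_add_right (entropyInf_le_algEntropy hL hLc hF hgK) _)
  -- With the infimum outside, each `D` may use its own intersection `H` with the image of `N`; the
  -- term L(H)/|D| then cancels.
  conv_rhs => rw [entropyInf, ENNReal.add_iInf]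
  refine le_iInf fun ⟨D, hD⟩ => ?_
  set H := trajectory c D K ⊓ LinearMap.range (resMap c f)
  have hHt : L H ≠ ∞ :=
    ne_top_of_le_ne_top (length_trajectory_ne_top hL hLc D hK) (hL.mono inf_le_left)
  have hHf : (H.comap (resMap c f)).map (resMap c f) = H :=
    Submodule.map_comap_eq_self inf_le_right
  have hHN : entropyInf c L H ≤ algEntropy c L F N := by
    rw [← hHf, entropyInf_map hL hf]
    refine entropyInf_le_algEntropy hL hLc hF ?_
    rw [← hL.map_of_injective (resMap_injective hf), hHf]
    exact hHt
  have h := entropyInf_add_le hL hLc hF hK hD (H := H) inf_le_left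
  rw [length_inf_range_add_map hL hfg (trajectory c D K), map_trajectory, ENNReal.add_div,
    add_comm (L H / _), ← add_assoc] at h
  have h' := (ENNReal.add_le_add_iff_right
    (ENNReal.div_ne_top hHt (by exact_mod_cast hD.card_ne_zero))).1 h
  exact h'.trans (add_le_add_left hHN _)

/-- If `H` lifts `Q`, the trajectory of H + f(K) meets the image of `N` in at least the trajectory
of f(K) and maps onto at least that of `Q`. -/
theorem add_le_algEntropy (hL : IsLengthFunction L) (hLd : IsDiscreteInvariant L)
    (hLc : IsCompatibleWith c L) {F : ℕ → Finset G} (hF : IsFolnerSeq F) (hM : lFin c L M)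
    (hf : Function.Injective f) (hfg : Function.Exact f g) (hg : Function.Surjective g) :
    algEntropy c L F N + algEntropy c L F P ≤ algEntropy c L F M := by
  rw [algEntropy_eq hL hLc hF N, algEntropy_eq hL hLc hF P]
  refine ENNReal.biSup_add_biSup_le' ⟨⊥, by simp [hL.bot]⟩ ⟨⊥, by simp [hL.bot]⟩
    fun K hK Q hQ => ?_
  -- An arbitrary lift of an `L`-finite submodule may have infinite length. A finitely generated one
  -- has a finitely generated lift, which is `L`-finite because `M` is in `lFin`.
  obtain ⟨Q', hQQ', hQfg, hQL⟩ := hL.exists_fg_le_eq hLd hQ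
  rw [← entropyInf_eq_of_length_eq hL hLc hF hQ hQQ' hQL]
  obtain ⟨H, hHfg, rfl⟩ := hQfg.exists_map_eq (g := resMap c g) hg
  have hfK : L (K.map (resMap c f)) ≠ ∞ := by
    rwa [hL.map_of_injective (resMap_injective hf)]
  refine le_trans ?_ (entropyInf_le_algEntropy hL hLc hF (hL.sup_ne_top (hM H hHfg) hfK))
  refine le_iInf fun D => (add_le_add (entropyInf_le _ D.2) (entropyInf_le _ D.2)).trans ?_
  rw [← ENNReal.add_div]
  refine ENNReal.div_le_div_right ?_ _
  rw [length_inf_range_add_map hL hfg (trajectory c D.1 _)]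
  refine add_le_add ?_ ?_
  · rw [← hL.map_of_injective (resMap_injective hf), map_trajectory]
    refine hL.mono (le_inf (trajectory_mono c _ le_sup_right) ?_)
    rw [← map_trajectory]
    exact LinearMap.map_le_range
  · rw [← map_trajectory]
    exact hL.mono (Submodule.map_mono (trajectory_mono c _ le_sup_left))

theorem algEntropy_isAdditiveOn (hL : IsLengthFunction L) (hLd : IsDiscreteInvariant L)
    (hLc : IsCompatibleWith c L) {F : ℕ → Finset G} (hF : IsFolnerSeq F) :
    IsAdditiveOn (lFin c L) (algEntropy c L F) := by
  refine ⟨fun M _ _ hM => le_antisymm (algEntropy_le hL hLc hF fun K _ => ?_) zero_le,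
    fun N M P _ _ _ _ _ _ f g hM hf hfg hg =>
      le_antisymm (algEntropy_le_add hL hLc hF hf hfg)
        (add_le_algEntropy hL hLd hLc hF hM hf hfg hg)⟩
  have : Subsingleton (RMod c M) := hM
  exact (entropyInf_le_length K).trans (hL.of_subsingleton inferInstance).le

end Properties

/-! ### Bernoulli shifts -/

namespace CrossedProduct

variable {R : Type u} {G : Type v} [Ring R] [Group G] (c : CrossedSystem R G)

/-- The coefficient of `u_g`. -/
noncomputable def coeff (g : G) : CrossedProduct c →+ R :=
  Finsupp.applyAddHom (M := R) g

theorem coeff_single_same (g : G) (r : R) : coeff c g (single c g r) = r :=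
  Finsupp.single_eq_same (M := R)

theorem coeff_single_of_ne {g h : G} (hgh : g ≠ h) (r : R) : coeff c g (single c h r) = 0 :=
  Finsupp.single_eq_of_ne (M := R) hgh

theorem coeff_ofRing_mul (g : G) (r : R) (s : CrossedProduct c) :
    coeff c g (ofRing c r * s) = r * coeff c g s := by
  refine DFunLike.congr_fun (f := (coeff c g).comp (AddMonoidHom.mulLeft (ofRing c r)))
    (g := (AddMonoidHom.mulLeft r).comp (coeff c g)) (addHom_ext fun h t => ?_) s
  change coeff c g (single c 1 r * single c h t) = r * coeff c g (single c h t)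
  rw [single_mul_single]
  by_cases hgh : g = h
  · subst hgh
    rw [one_mul, coeff_single_same, coeff_single_same]
    simp [c.σ_one, c.ρ_one_left]
  · rw [one_mul, coeff_single_of_ne c hgh, coeff_single_of_ne c hgh, mul_zero]

theorem coeff_mul_ofRing (g : G) (r : R) (s : CrossedProduct c) :
    coeff c g (s * ofRing c r) = coeff c g s * c.σ g r := by
  refine DFunLike.congr_fun (f := (coeff c g).comp (AddMonoidHom.mulRight (ofRing c r)))
    (g := (AddMonoidHom.mulRight (c.σ g r)).comp (coeff c g)) (addHom_ext fun h t => ?_) s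
  change coeff c g (single c h t * single c 1 r) = coeff c g (single c h t) * c.σ g r
  rw [single_mul_single]
  by_cases hgh : g = h
  · subst hgh
    rw [mul_one, coeff_single_same, coeff_single_same]
    simp [c.ρ_one_right]
  · rw [mul_one, coeff_single_of_ne c hgh, coeff_single_of_ne c hgh, zero_mul]

theorem induction_on {p : CrossedProduct c → Prop} (s : CrossedProduct c) (zero : p 0)
    (add : ∀ s t, p s → p t → p (s + t)) (single : ∀ g r, p (single c g r)) : p s :=
  Finsupp.induction_linear (M := R) s zero add single

end CrossedProduct

namespace BernoulliShift

open CrossedProduct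

/-! ### Coordinates on R*G ⊗_R K and independence of the translates -/

section Coordinates

variable {R : Type u} {G : Type v} [Ring R] [Group G] (c : CrossedSystem R G)
  {K : Type w} [AddCommGroup K] [Module R K]

/-- The element `s ⊗ k` of `R * G ⊗_R K`. -/
noncomputable def tmul (s : CrossedProduct c) (k : K) : BernoulliShift c K :=
  Submodule.Quotient.mk (s ⊗ₜ[ℤ] k)

theorem add_tmul (s t : CrossedProduct c) (k : K) :
    tmul c (s + t) k = tmul c s k + tmul c t k := by
  rw [tmul, TensorProduct.add_tmul, Submodule.Quotient.mk_add]; rfl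

theorem tmul_add (s : CrossedProduct c) (k l : K) :
    tmul c s (k + l) = tmul c s k + tmul c s l := by
  rw [tmul, TensorProduct.tmul_add, Submodule.Quotient.mk_add]; rfl

theorem smul_tmul (s t : CrossedProduct c) (k : K) : s • tmul c t k = tmul c (s * t) k := rfl

theorem mul_ofRing_tmul (s : CrossedProduct c) (r : R) (k : K) :
    tmul c (s * ofRing c r) k = tmul c s (r • k) :=
  (Submodule.Quotient.eq _).2 (Submodule.subset_span ⟨s, r, k, rfl⟩)

theorem single_tmul (g : G) (r : R) (k : K) :
    tmul c (single c g r) k = tmul c (basis c g) ((c.σ g).symm r • k) := by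
  rw [single_eq_basis_mul, mul_ofRing_tmul]

theorem induction_on {p : BernoulliShift c K → Prop} (x : BernoulliShift c K) (zero : p 0)
    (add : ∀ x y, p x → p y → p (x + y)) (tmul : ∀ s k, p (tmul c s k)) : p x := by
  obtain ⟨x, rfl⟩ := Submodule.Quotient.mk_surjective _ x
  induction x using TensorProduct.induction_on with
  | zero => exact zero
  | tmul s k => exact tmul s k
  | add x y hx hy => exact add _ _ hx hy

/-- The map `∑ r_h u_h ⊗ k ↦ r_g^{σ(g)⁻¹} k`, on the tensor product over `ℤ`. -/
noncomputable def preCoord (g : G) : CrossedProduct c ⊗[ℤ] K →+ K :=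
  TensorProduct.liftAddHom
    (((AddMonoidHom.smul (R := R) (M := K)).comp ((c.σ g).symm : R →+ R)).comp (coeff c g))
    fun r s k => by
      simp only [AddMonoidHom.comp_apply, map_zsmul, AddMonoidHom.coe_smul, Pi.smul_apply]

theorem preCoord_tmul (g : G) (s : CrossedProduct c) (k : K) :
    preCoord c g (s ⊗ₜ[ℤ] k) = (c.σ g).symm (coeff c g s) • k := rfl

theorem preCoord_eq_zero (g : G) {x : CrossedProduct c ⊗[ℤ] K}
    (hx : x ∈ balancedRelations (ofRing c) K) : preCoord c g x = 0 := by
  -- The span is additively generated by the multiples of the relations, so an additive map can be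
  -- tested on these without being linear over R*G.
  induction hx using Submodule.closure_induction with
  | zero => exact map_zero _
  | add x y _ _ hx hy => rw [map_add, hx, hy, add_zero]
  | smul_mem t x hx =>
    obtain ⟨s, r, k, rfl⟩ := hx
    rw [smul_sub, TensorProduct.smul_tmul', TensorProduct.smul_tmul', map_sub, preCoord_tmul,
      preCoord_tmul, smul_eq_mul, smul_eq_mul, ← mul_assoc, coeff_mul_ofRing, map_mul,
      RingEquiv.symm_apply_apply, mul_smul, sub_self]

/-- The map `∑ r_h u_h ⊗ k ↦ r_g^{σ(g)⁻¹} k`. -/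
noncomputable def coord (g : G) : BernoulliShift c K →+ K :=
  QuotientAddGroup.lift (balancedRelations (ofRing c) K).toAddSubgroup (preCoord c g)
    fun _ hx => preCoord_eq_zero c g hx

theorem coord_tmul (g : G) (s : CrossedProduct c) (k : K) :
    coord c g (tmul c s k) = (c.σ g).symm (coeff c g s) • k := rfl

theorem coord_smul (g : G) (r : R) (x : BernoulliShift c K) :
    coord c g (ofRing c r • x) = (c.σ g).symm r • coord c g x := by
  induction x using induction_on with
  | zero => simp
  | add x y hx hy => rw [smul_add, map_add, hx, hy, map_add, smul_add]
  | tmul s k => rw [smul_tmul, coord_tmul, coeff_ofRing_mul, map_mul, mul_smul, coord_tmul]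

theorem coord_basis_same (g : G) (k : K) : coord c g (tmul c (basis c g) k) = k := by
  rw [coord_tmul, basis, coeff_single_same, map_one, one_smul]

theorem coord_basis_of_ne {g h : G} (hgh : g ≠ h) (k : K) :
    coord c g (tmul c (basis c h) k) = 0 := by
  rw [coord_tmul, basis, coeff_single_of_ne c hgh, map_zero, zero_smul]

/-- The embedding `k ↦ 1 ⊗ k`. -/
noncomputable def incl (K : Type w) [AddCommGroup K] [Module R K] :
    K →ₗ[R] RMod c (BernoulliShift c K) where
  toFun := fun k => tmul c 1 k
  map_add' := tmul_add c 1
  map_smul' := fun r k => by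
    change tmul c 1 (r • k) = ofRing c r • tmul c 1 k
    rw [smul_tmul, ← mul_ofRing_tmul, mul_one, one_mul]

variable (K) in
theorem incl_injective : Function.Injective (incl c K) :=
  Function.LeftInverse.injective (g := coord c 1) fun k => coord_basis_same c 1 k

theorem basisAction_incl (g : G) (k : K) :
    basisAction c (BernoulliShift c K) g (incl c K k) = tmul c (basis c g) k := by
  change basis c g • tmul c 1 k = _
  rw [smul_tmul, mul_one]

variable (K) in
-- The coordinate at `g` vanishes on the translates by elements of `F`, but recovers `k` from u_g ⊗
-- k.
theorem trajectory_inf_translate {F : Finset G} {g : G} (hg : g ∉ F) :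
    translateSubmodule c g (LinearMap.range (incl c K)) ⊓
      trajectory c F (LinearMap.range (incl c K)) = ⊥ := by
  let Z : Submodule R (RMod c (BernoulliShift c K)) :=
    { carrier := {x | coord c g x = 0}
      zero_mem' := map_zero (coord c g)
      add_mem' := fun {x y} (hx : coord c g x = 0) (hy : coord c g y = 0) =>
        (map_add (coord c g) x y).trans ((congrArg₂ (· + ·) hx hy).trans (add_zero 0))
      smul_mem' := fun r x (hx : coord c g x = 0) =>
        (coord_smul c g r x).trans ((congrArg (_ • ·) hx).trans (smul_zero _)) }
  have hZ : trajectory c F (LinearMap.range (incl c K)) ≤ Z := by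
    rw [trajectory_le_iff]
    rintro h hh _ ⟨_, ⟨k, rfl⟩, rfl⟩
    rw [basisAction_incl]
    exact coord_basis_of_ne c (fun e : g = h => hg (by rwa [e])) k
  refine eq_bot_iff.2 ?_
  rintro _ ⟨⟨_, ⟨k, rfl⟩, rfl⟩, hx⟩
  have h : coord c g (basisAction c (BernoulliShift c K) g (incl c K k)) = 0 := hZ hx
  rw [basisAction_incl, coord_basis_same] at h
  rw [h, map_zero, map_zero]
  exact Submodule.zero_mem _

theorem exists_mem_trajectory (x : RMod c (BernoulliShift c K)) :
    ∃ F : Finset G, x ∈ trajectory c F (LinearMap.range (incl c K)) := by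
  classical
  have hadd : ∀ x y : RMod c (BernoulliShift c K),
      (∃ F : Finset G, x ∈ trajectory c F (LinearMap.range (incl c K))) →
      (∃ F : Finset G, y ∈ trajectory c F (LinearMap.range (incl c K))) →
      ∃ F : Finset G, x + y ∈ trajectory c F (LinearMap.range (incl c K)) := by
    rintro x y ⟨F, hF⟩ ⟨F', hF'⟩
    exact ⟨F ∪ F', Submodule.add_mem _ (trajectory_subset c Finset.subset_union_left _ hF)
      (trajectory_subset c Finset.subset_union_right _ hF')⟩
  refine induction_on c (p := fun x => ∃ F : Finset G,
    (show RMod c (BernoulliShift c K) from x) ∈ trajectory c F (LinearMap.range (incl c K)))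
    x ⟨∅, Submodule.zero_mem _⟩ hadd fun s k => ?_
  refine CrossedProduct.induction_on c (p := fun s => ∃ F : Finset G,
    (show RMod c (BernoulliShift c K) from tmul c s k) ∈
      trajectory c F (LinearMap.range (incl c K))) s ?_ ?_ ?_
  · refine ⟨∅, ?_⟩
    have h : tmul c 0 k = 0 := by rw [tmul, TensorProduct.zero_tmul, Submodule.Quotient.mk_zero]
    rw [h]
    exact Submodule.zero_mem _
  · intro s t hs ht
    rw [add_tmul]
    exact hadd _ _ hs ht
  · intro g r
    refine ⟨{g}, ?_⟩
    rw [trajectory_singleton, single_tmul, ← basisAction_incl]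
    exact Submodule.mem_map_of_mem (LinearMap.mem_range_self _ _)

theorem exists_le_trajectory {H : Submodule R (RMod c (BernoulliShift c K))} (hH : H.FG) :
    ∃ D : Finset G, D.Nonempty ∧ H ≤ trajectory c D (LinearMap.range (incl c K)) := by
  classical
  obtain ⟨F, hF⟩ := hH.exists_le_of_directed
    (T := fun F : Finset G => trajectory c F (LinearMap.range (incl c K)))
    (directed_of_isDirected_le fun _ _ h => trajectory_subset c h _)
    fun x _ => exists_mem_trajectory c x
  -- Adding 1 guarantees a non-empty set, by whose cardinality one may divide.
  exact ⟨insert 1 F, Finset.insert_nonempty _ _,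
    hF.trans (trajectory_subset c (Finset.subset_insert _ _) _)⟩

end Coordinates

/-! ### Length and entropy in a Bernoulli shift -/

section Length

variable {R : Type u} {G : Type v} [Ring R] [Group G] {c : CrossedSystem R G}
  {L : ModuleInvariant.{u, max u v w} R} (K : Type (max u v w)) [AddCommGroup K] [Module R K]

theorem length_range_incl (hL : IsLengthFunction L) :
    L (LinearMap.range (incl c K)) = L K :=
  (hL.congr (LinearEquiv.ofInjective _ (incl_injective c K))).symm

theorem length_trajectory (hL : IsLengthFunction L) (hLc : IsCompatibleWith c L) (F : Finset G) :
    L (trajectory c F (LinearMap.range (incl c K))) = F.card * L K := by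
  classical
  induction F using Finset.induction_on with
  | empty => rw [trajectory_empty, hL.bot]; simp
  | insert g F hg ih =>
    have h := hL.sup_add_inf (translateSubmodule c g (LinearMap.range (incl c K)))
      (trajectory c F (LinearMap.range (incl c K)))
    rw [trajectory_inf_translate c K hg, hL.bot, add_zero, length_translateSubmodule hL hLc,
      length_range_incl K hL, ih] at h
    rw [trajectory_insert, h, Finset.card_insert_of_notMem hg]
    push_cast
    ring

theorem length_trajectory_div (hL : IsLengthFunction L) (hLc : IsCompatibleWith c L)
    {D : Finset G} (hD : D.Nonempty) :
    L (trajectory c D (LinearMap.range (incl c K))) / (D.card : ℝ≥0∞) = L K := by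
  rw [length_trajectory K hL hLc, ENNReal.mul_div_right_comm,
    ENNReal.div_self (by exact_mod_cast hD.card_ne_zero) (ENNReal.natCast_ne_top _), one_mul]

theorem entropyInf_range_incl (hL : IsLengthFunction L) (hLc : IsCompatibleWith c L) :
    entropyInf c L (LinearMap.range (incl c K)) = L K := by
  have : Nonempty {D : Finset G // D.Nonempty} := ⟨⟨{1}, Finset.singleton_nonempty 1⟩⟩
  rw [entropyInf, iInf_congr fun D => length_trajectory_div K hL hLc D.2, iInf_const]

variable {K}

theorem mem_lFin (hL : IsLengthFunction L) (hLc : IsCompatibleWith c L) (hK : L K ≠ ∞) :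
    lFin c L (BernoulliShift c K) := by
  intro H hH
  obtain ⟨D, -, hD⟩ := exists_le_trajectory c hH
  exact ne_top_of_le_ne_top (length_trajectory_ne_top hL hLc D (by rwa [length_range_incl K hL]))
    (hL.mono hD)

/-- The trajectory over `F n` of T_D(Q) lies in that of `Q` over the product set F_n D, which
exceeds `F n` by at most a boundary. -/
theorem entropyInf_trajectory_le (hL : IsLengthFunction L) (hLc : IsCompatibleWith c L)
    {F : ℕ → Finset G} (hF : IsFolnerSeq F) (hK : L K ≠ ∞) (D : Finset G) :
    entropyInf c L (trajectory c D (LinearMap.range (incl c K))) ≤ L K := by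
  classical
  set Q := LinearMap.range (incl c K)
  have hlim : Filter.Tendsto (fun n => L K +
      boundaryRatio (insert 1 (D.image (·⁻¹))) (F n) * L K) Filter.atTop (𝓝 (L K + 0 * L K)) :=
    tendsto_const_nhds.add
      (ENNReal.Tendsto.mul_const (hF.tendsto_boundaryRatio _) (Or.inr hK))
  rw [zero_mul, add_zero] at hlim
  refine ge_of_tendsto' hlim fun n => (entropyInf_le _ (hF.1 n)).trans ?_
  have h : L (trajectory c (F n) (trajectory c D Q)) ≤ (F n).card * L K +
      (cBoundary ((insert 1 (D.image (·⁻¹)) : Finset G) : Set G) (F n : Set G)).ncard * L K := by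
    refine (hL.mono (trajectory_trajectory_le c (F n) D Q)).trans ?_
    rw [length_trajectory K hL hLc, ← add_mul]
    refine mul_le_mul_left ?_ _
    have h₁ := card_mul_sdiff_le (F n) D
    have h₂ := Finset.card_le_card_sdiff_add_card (s := Finset.image₂ (· * ·) (F n) D) (t := F n)
    exact_mod_cast (show _ ≤ _ by omega)
  refine (ENNReal.div_le_div_right h _).trans_eq ?_
  rw [ENNReal.add_div, ENNReal.mul_div_right_comm, ENNReal.mul_div_right_comm,
    ENNReal.div_self (by exact_mod_cast (hF.1 n).card_ne_zero) (ENNReal.natCast_ne_top _), one_mul,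
    boundaryRatio]

theorem algEntropy_eq (hL : IsLengthFunction L) (hLd : IsDiscreteInvariant L)
    (hLc : IsCompatibleWith c L) {F : ℕ → Finset G} (hF : IsFolnerSeq F) (hK : L K ≠ ∞) :
    algEntropy c L F (BernoulliShift c K) = L K := by
  have hK' : L (LinearMap.range (incl c K)) ≠ ∞ := by rwa [length_range_incl K hL]
  apply le_antisymm
  · refine algEntropy_le_of_fg hL hLd hLc hF fun H hH _ => ?_
    obtain ⟨D, -, hD⟩ := exists_le_trajectory c hH
    exact (entropyInf_mono hL hD).trans (entropyInf_trajectory_le hL hLc hF hK D)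
  · rw [← entropyInf_range_incl K hL hLc]
    exact entropyInf_le_algEntropy hL hLc hF hK'

/-- In `entropyInf_add_le` for the copy 1 ⊗ K, the entropy and the averaged length of the trajectory
are both L(K) and cancel. -/
theorem div_le_entropyInf (hL : IsLengthFunction L) (hLc : IsCompatibleWith c L)
    {F : ℕ → Finset G} (hF : IsFolnerSeq F) (hK : L K ≠ ∞)
    {H : Submodule R (RMod c (BernoulliShift c K))} {D : Finset G} (hD : D.Nonempty)
    (hH : H ≤ trajectory c D (LinearMap.range (incl c K))) :
    L H / (D.card : ℝ≥0∞) ≤ entropyInf c L H := by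
  have h := entropyInf_add_le hL hLc hF (by rwa [length_range_incl K hL]) hD hH
  rw [entropyInf_range_incl K hL hLc, length_trajectory_div K hL hLc hD, add_comm] at h
  exact (ENNReal.add_le_add_iff_right hK).1 h

/-- Zero entropy forces zero length on finitely generated `R`-submodules by `div_le_entropyInf`, and
upper continuity of `L` extends this to `N`. Conversely, entropy never exceeds length. -/
theorem algEntropy_submodule_eq_zero_iff (hL : IsLengthFunction L) (hLc : IsCompatibleWith c L)
    {F : ℕ → Finset G} (hF : IsFolnerSeq F) (hK : L K ≠ ∞)
    (N : Submodule (CrossedProduct c) (BernoulliShift c K)) :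
    algEntropy c L F N = 0 ↔ L (RMod c N) = 0 := by
  constructor
  · intro h
    refine hL.eq_zero_of_fg fun H hH => ?_
    have hinj : Function.Injective (resMap c N.subtype) := resMap_injective N.injective_subtype
    obtain ⟨D, hD, hHD⟩ := exists_le_trajectory c (hH.map (resMap c N.subtype))
    have hHt : L H ≠ ∞ := by
      rw [← hL.map_of_injective hinj]
      exact mem_lFin hL hLc hK _ (hH.map _)
    have h₁ := div_le_entropyInf hL hLc hF hK hD hHD
    rw [entropyInf_map hL N.injective_subtype, hL.map_of_injective hinj] at h₁
    have h₂ := le_antisymm (h₁.trans ((entropyInf_le_algEntropy hL hLc hF hHt).trans h.le)) zero_le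
    exact (ENNReal.div_eq_zero_iff.1 h₂).resolve_right (ENNReal.natCast_ne_top _)
  · intro h
    refine le_antisymm (algEntropy_le hL hLc hF fun H _ => ?_) zero_le
    exact (entropyInf_le_length H).trans ((hL.mono le_top).trans (hL.top.trans h).le)

end Length

end BernoulliShift

theorem theorem6p1
    {R : Type u} {G : Type v} [Ring R] [Group G] [Group.FG G] [Infinite G] (hG : IsAmenable G)
    (c : CrossedSystem R G)
    (L : ModuleInvariant.{u, max u v w} R) (hL : IsLengthFunction L)
    (hLd : IsDiscreteInvariant L) (hLc : IsCompatibleWith c L) :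
    -- the entropy is well defined: Følner sequences exist, the limit exists along each of them,
    -- and it does not depend on the choice
    (∃ F : ℕ → Finset G, IsFolnerSeq F) ∧
    (∀ F F' : ℕ → Finset G, IsFolnerSeq F → IsFolnerSeq F' →
      ∀ (M : Type (max u v w)) [AddCommGroup M] [Module (CrossedProduct c) M], lFin c L M →
        ∀ K : Submodule R (RMod c M), L K ≠ ∞ →
          Filter.Tendsto (entropyTerm c L F K) Filter.atTop (𝓝 (entropyAt c L F K)) ∧
          entropyAt c L F K = entropyAt c L F' K) ∧
    ∀ F : ℕ → Finset G, IsFolnerSeq F →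
      IsUpperContinuousOn (lFin c L) (algEntropy c L F) ∧
      (∀ (K : Type (max u v w)) [AddCommGroup K] [Module R K], L K ≠ ∞ →
        lFin c L (BernoulliShift c K) ∧
        algEntropy c L F (BernoulliShift c K) = L K ∧
        ∀ N : Submodule (CrossedProduct c) (BernoulliShift c K),
          algEntropy c L F N = 0 ↔ L (RMod c N) = 0) ∧
      IsAdditiveOn (lFin c L) (algEntropy c L F) ∧
      IsLengthFunctionOn (lFin c L) (algEntropy c L F) := by
  refine ⟨hG.exists_folnerSeq, fun F F' hF hF' M _ _ _ K hK => ?_, fun F hF => ?_⟩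
  · rw [entropyAt_eq hL hLc hF hK, entropyAt_eq hL hLc hF' hK]
    exact ⟨tendsto_entropyTerm hL hLc hF hK, rfl⟩
  · have huc := algEntropy_isUpperContinuousOn hL hLd hLc hF (lFin c L)
    have hadd := algEntropy_isAdditiveOn hL hLd hLc hF
    exact ⟨huc, fun K _ _ hK => ⟨BernoulliShift.mem_lFin.{u, v, w} hL hLc hK,
      BernoulliShift.algEntropy_eq.{u, v, w} hL hLd hLc hF hK,
      BernoulliShift.algEntropy_submodule_eq_zero_iff.{u, v, w} hL hLc hF hK⟩,
      hadd, algEntropy_isInvariantOn hL hLc hF _, hadd, huc⟩
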